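/- Let $\mathcal H_2$ be the Siegel half-space of degree $2$, i.e. the set of symmetric matrices $\tau\in M_2(\mathbb C)$ with $\operatorname{Im}\tau$ positive definite. For $a,b\in\mathbb R^2$ (row vectors) put \[ \Theta_{a,b}(\tau)=\sum_{n\in\mathbb Z^2} e^{\,i\pi (n+a)\tau\,{}^t(n+a)+2i\pi (n+a)\,{}^tb}, \] and for a quadruple $m=(m_1m_2m_3m_4)$ put $\Theta_{m/2}=\Theta_{(m_1/2,\,m_2/2),(m_3/2,\,m_4/2)}$. Let \[ E=\{(0000),(0001),(0010),(0011),(0100),(0110),(1000),(1001),(1100),(1111)\} \] be the set of the ten even characteristics. The group $\operatorname{Sp}_4(\mathbb Z)$ acts on $\mathcal H_2$ by $\gamma\cdot\tau=(A\tau+B)(C\tau+D)^{-1}$ for $\gamma=\begin{pmatrix}A&B\\C&D\end{pmatrix}$. Let $\mathcal F_2$ be the usual (closed) fundamental domain for this action: the set of $\tau\in\mathcal H_2$ such that all entries of $\operatorname{Re}\tau$ have absolute value at most $1/2$, the matrix $\operatorname{Im}\tau=\begin{pmatrix}y_1&y_2\\y_2&y_4\end{pmatrix}$ is Minkowski reduced,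 i.e. $0\le 2y_2\le y_1\le y_4$, and $|\det(C\tau+D)|\ge 1$ for every $\begin{pmatrix}A&B\\C&D\end{pmatrix}\in\operatorname{Sp}_4(\mathbb Z)$. For every $\tau\in\mathcal H_2$ and every real number $t\ge\sqrt3/2$: (a) At most six of the ten characteristics $m\in E$ satisfy \[ |\Theta_{m/2}(\tau)|<0.42\,\max_{m'\in E}|\Theta_{m'/2}(\tau)|. \] (b) If the orbit of $\tau$ under $\operatorname{Sp}_4(\mathbb Z)$ has a representative in $\mathcal F_2$ whose lower-right entry has imaginary part $y_4\le t$, then at most one of the ten characteristics $m\in E$ satisfies \[ |\Theta_{m/2}(\tau)|<1.22\,e^{-\pi t}\max_{m'\in E}|\Theta_{m'/2}(\tau)|. \] -/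

import Mathlib

noncomputable section

namespace SiegelTheta

/-- The Siegel upper half-space `ℋ_g`: symmetric complex matrices with positive definite
imaginary part. -/
def siegelHalfSpace (g : ℕ) : Set (Matrix (Fin g) (Fin g) ℂ) :=
  {τ | τ.transpose = τ ∧ (τ.map Complex.im).PosDef}

/-- The theta function with characteristics `a, b ∈ ℝ^g`,
`Θ_{a,b}(z, τ) = ∑_{n ∈ ℤ^g} exp (iπ (n+a) τ ᵗ(n+a) + 2iπ (n+a) ᵗ(z+b))`. -/
def theta {g : ℕ} (a b : Fin g → ℝ) (z : Fin g → ℂ) (τ : Matrix (Fin g) (Fin g) ℂ) : ℂ :=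
  ∑' n : Fin g → ℤ,
    Complex.exp
      (Complex.I * Real.pi *
          ((fun i => (n i : ℂ) + (a i : ℂ)) ⬝ᵥ
            (τ.mulVec fun i => (n i : ℂ) + (a i : ℂ))) +
        2 * Complex.I * Real.pi *
          ((fun i => (n i : ℂ) + (a i : ℂ)) ⬝ᵥ fun i => z i + (b i : ℂ)))

/-- The set `E` of the ten even characteristics, as quadruples of zeros and ones. -/
def evenChars : Finset (Fin 4 → ℕ) :=
  {![0, 0, 0, 0], ![0, 0, 0, 1], ![0, 0, 1, 0], ![0, 0, 1, 1], ![0, 1, 0, 0],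
    ![0, 1, 1, 0], ![1, 0, 0, 0], ![1, 0, 0, 1], ![1, 1, 0, 0], ![1, 1, 1, 1]}

theorem evenChars_card : evenChars.card = 10 := by decide

theorem evenChars_nonempty : evenChars.Nonempty := ⟨![0, 0, 0, 0], by decide⟩

/-- The theta constant `Θ_{m/2}(τ) = Θ_{a,b}(0, τ)` of degree two, with
`a = (m₁/2, m₂/2)` and `b = (m₃/2, m₄/2)`. -/
def thetaConst (m : Fin 4 → ℕ) (τ : Matrix (Fin 2) (Fin 2) ℂ) : ℂ :=
  theta ![(m 0 : ℝ) / 2, (m 1 : ℝ) / 2] ![(m 2 : ℝ) / 2, (m 3 : ℝ) / 2] 0 τ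

/-- `max_{m ∈ E} |Θ_{m/2}(τ)|`. -/
def maxThetaConst (τ : Matrix (Fin 2) (Fin 2) ℂ) : ℝ :=
  evenChars.sup' evenChars_nonempty fun m => ‖thetaConst m τ‖

/-- For `γ = (A B; C D)`, the automorphy factor `C τ + D`. -/
def autFactor {g : ℕ} (γ : Matrix (Fin g ⊕ Fin g) (Fin g ⊕ Fin g) ℤ)
    (τ : Matrix (Fin g) (Fin g) ℂ) : Matrix (Fin g) (Fin g) ℂ :=
  γ.toBlocks₂₁.map (Int.cast : ℤ → ℂ) * τ + γ.toBlocks₂₂.map (Int.cast : ℤ → ℂ)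

/-- For `γ = (A B; C D)`, the matrix `γ · τ = (A τ + B) (C τ + D)⁻¹`. -/
def siegelAct {g : ℕ} (γ : Matrix (Fin g ⊕ Fin g) (Fin g ⊕ Fin g) ℤ)
    (τ : Matrix (Fin g) (Fin g) ℂ) : Matrix (Fin g) (Fin g) ℂ :=
  (γ.toBlocks₁₁.map (Int.cast : ℤ → ℂ) * τ + γ.toBlocks₁₂.map (Int.cast : ℤ → ℂ)) *
    (autFactor γ τ)⁻¹

/-- The usual (Siegel) fundamental domain `ℱ₂` for the action of `Sp₄(ℤ)` on `ℋ₂`: the entries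
of the real part are at most `1/2` in absolute value, the imaginary part `(y₁ y₂; y₂ y₄)` is
Minkowski reduced, i.e. `0 ≤ 2 y₂ ≤ y₁ ≤ y₄`, and `|det (C τ + D)| ≥ 1` for every
`(A B; C D) ∈ Sp₄(ℤ)`. -/
def fundamentalDomain : Set (Matrix (Fin 2) (Fin 2) ℂ) :=
  {τ | τ ∈ siegelHalfSpace 2 ∧
    (∀ i j, |(τ i j).re| ≤ 1 / 2) ∧
    (0 ≤ 2 * (τ 0 1).im ∧ 2 * (τ 0 1).im ≤ (τ 0 0).im ∧ (τ 0 0).im ≤ (τ 1 1).im) ∧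
    ∀ γ ∈ Matrix.symplecticGroup (Fin 2) ℤ, 1 ≤ ‖(autFactor γ τ).det‖}

end SiegelTheta

end

namespace SiegelTheta

open Matrix

/-! Part (a) is algebraic and holds at every point of the half-space. The duplication formula
(`thetaSum_sq`) writes the squares of the ten even theta constants as quadratic forms in four values
`A, B, C, D` of theta series at `2τ`. Hence their fourth powers satisfy four-term linear relations
with coefficients `±1` (`sum_quarticRelation`). In a relation containing the largest theta constant,
one of the three other terms must have modulus at least `3^(-1/4)` times the maximum, and `0.42` is
well below that. For each even characteristic there are three such relations sharing only that
characteristic, so at least four theta constants are large and at most six are small.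

Part (b) first moves to the fundamental domain. Up to a common positive factor, every element of the
symplectic group permutes the moduli of the theta constants and preserves parity
(`permutesThetas_of_mem_symplecticGroup`), so the number of small even ones is constant on orbits.
On the domain `y₁ ≥ √3/2`, and each series is its few leading terms plus a remainder dominated by a
product of two geometric series. This gives a maximum of at most `2.33`, and a lower bound `1.22 ·
2.33 · exp (-π y₄)` for every even theta constant except `(1111)`. That one is exempt because it
vanishes on diagonal matrices. -/

/-! ### The half-space in coordinates, and theta constants as absolutely convergent double sums -/

theorem mem_siegelHalfSpace_two_iff {τ : Matrix (Fin 2) (Fin 2) ℂ} :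
    τ ∈ siegelHalfSpace 2 ↔ τ 1 0 = τ 0 1 ∧ 0 < (τ 0 0).im ∧
      (τ 0 1).im ^ 2 < (τ 0 0).im * (τ 1 1).im := by
  constructor
  · rintro ⟨hs, hp⟩
    have h10 : τ 1 0 = τ 0 1 := congrFun (congrFun hs 0) 1
    refine ⟨h10, by simpa using hp.diag_pos (i := 0), ?_⟩
    have := hp.det_pos
    rw [Matrix.det_fin_two] at this
    simp only [Matrix.map_apply, h10] at this
    nlinarith
  · rintro ⟨h10, hp, hd⟩
    refine ⟨by ext i j; fin_cases i <;> fin_cases j <;> simp [h10], ?_⟩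
    refine Matrix.PosDef.of_dotProduct_mulVec_pos ?_ ?_
    · ext i j; fin_cases i <;> fin_cases j <;> simp [h10]
    · intro x hx
      simp only [dotProduct, mulVec, Fin.sum_univ_two, Matrix.map_apply, Pi.star_apply,
        star_trivial, h10]
      set p := (τ 0 0).im
      set q := (τ 0 1).im
      set r := (τ 1 1).im
      have key : p * (x 0 * (p * x 0 + q * x 1) + x 1 * (q * x 0 + r * x 1)) =
          (p * x 0 + q * x 1) ^ 2 + (p * r - q ^ 2) * x 1 ^ 2 := by ring
      refine pos_of_mul_pos_right (a := p) ?_ hp.le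
      rw [key]
      rcases eq_or_ne (x 1) 0 with h1 | h1
      · have h0 : x 0 ≠ 0 := fun h0 => hx (by ext i; fin_cases i <;> simp [h0, h1])
        rw [h1]
        have : 0 < (p * x 0) ^ 2 := by positivity
        simpa using this
      · have : 0 < (p * r - q ^ 2) * x 1 ^ 2 := mul_pos (by linarith) (by positivity)
        positivity

/-- The general term of the degree two theta series with characteristic `(a b c d) / 2`, at the
matrix `(p q; q r)`. -/
noncomputable def thetaTerm (p q r : ℂ) (a b c d : ℤ) (n : ℤ × ℤ) : ℂ :=
  Complex.exp (Real.pi * Complex.I *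
    (p * (n.1 + a / 2) ^ 2 + 2 * q * (n.1 + a / 2) * (n.2 + b / 2) + r * (n.2 + b / 2) ^ 2 +
      (n.1 + a / 2) * c + (n.2 + b / 2) * d))

/-- The degree two theta constant with characteristic `(a b c d) / 2`, as a sum over pairs. -/
noncomputable def thetaSum (p q r : ℂ) (a b c d : ℤ) : ℂ := ∑' n, thetaTerm p q r a b c d n

theorem thetaConst_eq_thetaSum {τ : Matrix (Fin 2) (Fin 2) ℂ} (h : τ 1 0 = τ 0 1)
    (m : Fin 4 → ℕ) :
    thetaConst m τ = thetaSum (τ 0 0) (τ 0 1) (τ 1 1) (m 0) (m 1) (m 2) (m 3) := by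
  rw [thetaConst, theta, thetaSum, ← (finTwoArrowEquiv ℤ).symm.tsum_eq]
  refine tsum_congr fun n => ?_
  simp only [thetaTerm, finTwoArrowEquiv_symm_apply, dotProduct, mulVec, Fin.sum_univ_two,
    Matrix.cons_val_zero, Matrix.cons_val_one, h, Pi.zero_apply]
  congr 1
  push_cast
  ring

/-- The quadratic form of the real symmetric matrix `(p q; q r)`. -/
noncomputable def binForm (p q r x y : ℝ) : ℝ := p * x ^ 2 + 2 * q * x * y + r * y ^ 2

theorem norm_thetaTerm (p q r : ℂ) (a b c d : ℤ) (n : ℤ × ℤ) :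
    ‖thetaTerm p q r a b c d n‖ =
      Real.exp (-Real.pi * binForm p.im q.im r.im (n.1 + a / 2) (n.2 + b / 2)) := by
  rw [thetaTerm, Complex.norm_exp]
  congr 1
  have e : (p * ((n.1 : ℂ) + a / 2) ^ 2 + 2 * q * (n.1 + a / 2) * (n.2 + b / 2) +
      r * (n.2 + b / 2) ^ 2 + (n.1 + a / 2) * c + (n.2 + b / 2) * d) =
      ((n.1 + a / 2 : ℝ) ^ 2 : ℝ) * p + (2 * (n.1 + a / 2) * (n.2 + b / 2) : ℝ) * q +
      ((n.2 + b / 2 : ℝ) ^ 2 : ℝ) * r +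
      (((n.1 + a / 2) * c + (n.2 + b / 2) * d : ℝ) : ℂ) := by
    push_cast; ring
  rw [e, mul_assoc, Complex.re_ofReal_mul, Complex.I_mul_re]
  simp only [Complex.add_im, Complex.im_ofReal_mul, Complex.ofReal_im, binForm]
  ring

/-- The witness is determinant over trace, which is at most the smaller eigenvalue. -/
theorem binForm_lower_bound {p q r : ℝ} (hp : 0 < p) (hd : q ^ 2 < p * r) :
    ∃ ε > 0, ∀ x y, ε * (x ^ 2 + y ^ 2) ≤ binForm p q r x y := by
  have hr : 0 < r := by by_contra h; nlinarith [sq_nonneg q]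
  refine ⟨(p * r - q ^ 2) / (p + r), by apply div_pos <;> linarith, fun x y => ?_⟩
  rw [div_mul_eq_mul_div, div_le_iff₀ (by linarith), binForm]
  nlinarith [sq_nonneg (p * x + q * y), sq_nonneg (q * x + r * y)]

theorem summable_exp_neg_sq {ε : ℝ} (hε : 0 < ε) (s : ℝ) :
    Summable fun n : ℤ => Real.exp (-Real.pi * (ε * (n + s) ^ 2)) := by
  -- Expanding `ε (n + s) ^ 2`, the terms in `n` give the modulus of a Jacobi theta term with purely
  -- imaginary arguments; `ε s ^ 2` is a constant factor.
  have h := ((summable_jacobiTheta₂_term_iff ((ε * s : ℝ) * Complex.I)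
    ((ε : ℝ) * Complex.I)).2 (by simpa using hε)).norm.mul_left (Real.exp (-Real.pi * (ε * s ^ 2)))
  refine h.congr fun n => ?_
  rw [norm_jacobiTheta₂_term, ← Real.exp_add]
  congr 1
  simp only [Complex.im_ofReal_mul, Complex.I_im]
  ring

theorem summable_norm_thetaTerm {p q r : ℂ} (hp : 0 < p.im) (hd : q.im ^ 2 < p.im * r.im)
    (a b c d : ℤ) : Summable fun n => ‖thetaTerm p q r a b c d n‖ := by
  obtain ⟨ε, hε, h⟩ := binForm_lower_bound hp hd
  have hs := (summable_exp_neg_sq hε (a / 2)).mul_of_nonneg (summable_exp_neg_sq hε (b / 2))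
    (fun _ => (Real.exp_pos _).le) (fun _ => (Real.exp_pos _).le)
  refine Summable.of_nonneg_of_le (fun _ => norm_nonneg _) (fun n => ?_) hs
  rw [norm_thetaTerm, ← Real.exp_add, Real.exp_le_exp]
  nlinarith [h (n.1 + a / 2) (n.2 + b / 2), Real.pi_pos]

theorem summable_thetaTerm {p q r : ℂ} (hp : 0 < p.im) (hd : q.im ^ 2 < p.im * r.im)
    (a b c d : ℤ) : Summable (thetaTerm p q r a b c d) :=
  (summable_norm_thetaTerm hp hd a b c d).of_norm

/-! ### Behaviour under changes of the characteristic -/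

theorem norm_exp_pi_mul_I_mul_int (k : ℤ) : ‖Complex.exp (Real.pi * Complex.I * (k / 4))‖ = 1 := by
  rw [show (Real.pi * Complex.I * (k / 4) : ℂ) = ((Real.pi * k / 4 : ℝ) : ℂ) * Complex.I by
    push_cast; ring, Complex.norm_exp_ofReal_mul_I]

theorem exp_pi_mul_I_mul_two_mul_int (k : ℤ) :
    Complex.exp (Real.pi * Complex.I * (2 * k)) = 1 := by
  rw [show (Real.pi * Complex.I * (2 * k) : ℂ) = k * (2 * Real.pi * Complex.I) by ring,
    Complex.exp_int_mul_two_pi_mul_I]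

theorem thetaSum_add_two_left (p q r : ℂ) (a b c d k l : ℤ) :
    thetaSum p q r (a + 2 * k) (b + 2 * l) c d = thetaSum p q r a b c d := by
  rw [thetaSum, thetaSum, ← ((Equiv.addRight k).prodCongr (Equiv.addRight l)).tsum_eq
    (thetaTerm p q r a b c d)]
  refine tsum_congr fun n => ?_
  simp only [thetaTerm, Equiv.prodCongr_apply, Equiv.coe_addRight, Prod.map]
  congr 1
  push_cast
  ring

theorem thetaTerm_eq_mul_of_quarter {p q r p' q' r' : ℂ} {a b c d a' b' c' d' : ℤ} {n n' : ℤ × ℤ}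
    (k l : ℤ)
    (h : p' * (n'.1 + a' / 2) ^ 2 + 2 * q' * (n'.1 + a' / 2) * (n'.2 + b' / 2) +
        r' * (n'.2 + b' / 2) ^ 2 + (n'.1 + a' / 2) * c' + (n'.2 + b' / 2) * d' =
      p * (n.1 + a / 2) ^ 2 + 2 * q * (n.1 + a / 2) * (n.2 + b / 2) + r * (n.2 + b / 2) ^ 2 +
        (n.1 + a / 2) * c + (n.2 + b / 2) * d + k / 4 + 2 * l) :
    thetaTerm p' q' r' a' b' c' d' n' =
      Complex.exp (Real.pi * Complex.I * (k / 4)) * thetaTerm p q r a b c d n := by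
  rw [thetaTerm, thetaTerm, h, mul_add _ _ (2 * (l : ℂ)), mul_add _ _ ((k : ℂ) / 4),
    Complex.exp_add, Complex.exp_add, exp_pi_mul_I_mul_two_mul_int]
  ring

/-- Common pattern of the transformations that only relabel terms: the exponent changes by a
constant `k / 4`, giving an eighth root of unity, and by an even integer depending on `n`, which has
no effect. -/
theorem norm_thetaSum_eq_of_quarter {p q r p' q' r' : ℂ} {a b c d a' b' c' d' : ℤ}
    (e : ℤ × ℤ ≃ ℤ × ℤ) (k : ℤ) (l : ℤ × ℤ → ℤ)
    (h : ∀ n : ℤ × ℤ, p' * ((e n).1 + a' / 2) ^ 2 +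
        2 * q' * ((e n).1 + a' / 2) * ((e n).2 + b' / 2) +
        r' * ((e n).2 + b' / 2) ^ 2 + ((e n).1 + a' / 2) * c' + ((e n).2 + b' / 2) * d' =
      p * (n.1 + a / 2) ^ 2 + 2 * q * (n.1 + a / 2) * (n.2 + b / 2) + r * (n.2 + b / 2) ^ 2 +
        (n.1 + a / 2) * c + (n.2 + b / 2) * d + k / 4 + 2 * l n) :
    ‖thetaSum p' q' r' a' b' c' d'‖ = ‖thetaSum p q r a b c d‖ := by
  rw [thetaSum, ← e.tsum_eq, tsum_congr fun n => thetaTerm_eq_mul_of_quarter k (l n) (h n),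
    tsum_mul_left, norm_mul, norm_exp_pi_mul_I_mul_int, one_mul, thetaSum]

theorem norm_thetaSum_add_two_right (p q r : ℂ) (a b c d k l : ℤ) :
    ‖thetaSum p q r a b (c + 2 * k) (d + 2 * l)‖ = ‖thetaSum p q r a b c d‖ := by
  refine norm_thetaSum_eq_of_quarter (Equiv.refl _) (4 * (a * k + b * l))
    (fun n => n.1 * k + n.2 * l) fun n => ?_
  simp only [Equiv.refl_apply]
  push_cast
  ring

theorem norm_thetaSum_congr (p q r : ℂ) {a b c d a' b' c' d' : ℤ} (ha : a ≡ a' [ZMOD 2])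
    (hb : b ≡ b' [ZMOD 2]) (hc : c ≡ c' [ZMOD 2]) (hd : d ≡ d' [ZMOD 2]) :
    ‖thetaSum p q r a b c d‖ = ‖thetaSum p q r a' b' c' d'‖ := by
  obtain ⟨i, hi⟩ := ha.dvd
  obtain ⟨j, hj⟩ := hb.dvd
  obtain ⟨k, hk⟩ := hc.dvd
  obtain ⟨l, hl⟩ := hd.dvd
  rw [show a' = a + 2 * i by omega, show b' = b + 2 * j by omega, show c' = c + 2 * k by omega,
    show d' = d + 2 * l by omega, thetaSum_add_two_left, norm_thetaSum_add_two_right]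

/-! ### Transformation formulas -/

/-- Since `n ^ 2 ≡ n` modulo 2, the new quadratic terms `s n₁ ^ 2` and `u n₂ ^ 2` can be replaced by
linear ones, which are absorbed into the lower half of the characteristic. -/
theorem norm_thetaSum_translate (p q r : ℂ) (a b c d s t u : ℤ) :
    ‖thetaSum (p + s) (q + t) (r + u) a b c d‖ =
      ‖thetaSum p q r a b (c + s * (1 + a) + t * b) (d + t * a + u * (1 + b))‖ := by
  have two_dvd (n : ℤ) : ∃ m, n ^ 2 - n = 2 * m := by
    obtain ⟨m, hm⟩ := Int.even_mul_pred_self n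
    exact ⟨m, by linear_combination hm⟩
  choose f hf using two_dvd
  refine norm_thetaSum_eq_of_quarter (Equiv.refl _)
    (-(s * a * (2 + a) + 2 * t * a * b + u * b * (2 + b)))
    (fun n => s * f n.1 + t * n.1 * n.2 + u * f n.2) fun n => ?_
  have h1 : (n.1 : ℂ) ^ 2 - n.1 = 2 * (f n.1 : ℂ) := by exact_mod_cast hf n.1
  have h2 : (n.2 : ℂ) ^ 2 - n.2 = 2 * (f n.2 : ℂ) := by exact_mod_cast hf n.2
  simp only [Equiv.refl_apply]
  push_cast
  linear_combination (s : ℂ) * h1 + (u : ℂ) * h2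

/-- Substitution `n ↦ n U` in the lattice with `U = (e f; g h)`; the integer `δ = ±1` makes the
inverse integral. -/
theorem thetaSum_congr_unimodular (p q r : ℂ) {e f g h δ : ℤ} (hδ : (e * h - f * g) * δ = 1)
    (a b c d : ℤ) :
    thetaSum (e ^ 2 * p + 2 * e * f * q + f ^ 2 * r) (e * g * p + (e * h + f * g) * q + f * h * r)
      (g ^ 2 * p + 2 * g * h * q + h ^ 2 * r) a b (e * c + f * d) (g * c + h * d) =
    thetaSum p q r (e * a + g * b) (f * a + h * b) c d := by
  let E : ℤ × ℤ ≃ ℤ × ℤ :=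
    { toFun := fun n => (e * n.1 + g * n.2, f * n.1 + h * n.2)
      invFun := fun n => (δ * (h * n.1 - g * n.2), δ * (e * n.2 - f * n.1))
      left_inv := fun n => by
        ext
        · linear_combination n.1 * hδ
        · linear_combination n.2 * hδ
      right_inv := fun n => by
        ext
        · linear_combination n.1 * hδ
        · linear_combination n.2 * hδ }
  rw [thetaSum, thetaSum, ← E.tsum_eq (thetaTerm p q r _ _ c d)]
  refine tsum_congr fun n => ?_
  simp only [thetaTerm, E, Equiv.coe_fn_mk]
  congr 1
  push_cast
  ring

/-- The determinant of the imaginary part is divided by `|p| ^ 2`. -/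
theorem partialInversion_im {p q r : ℂ} (hp : 0 < p.im) (hd : q.im ^ 2 < p.im * r.im) :
    0 < (-1 / p).im ∧ (q / p).im ^ 2 < (-1 / p).im * (r - q ^ 2 / p).im := by
  have hp0 : p ≠ 0 := fun h => by simp [h] at hp
  have hN : 0 < Complex.normSq p := Complex.normSq_pos.2 hp0
  have hN' : Complex.normSq p = p.re ^ 2 + p.im ^ 2 := by rw [Complex.normSq_apply]; ring
  have e1 : (-1 / p).im = p.im / Complex.normSq p := by
    rw [Complex.div_im]; simp [neg_div]
  have e2 : (q / p).im = (q.im * p.re - q.re * p.im) / Complex.normSq p := by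
    rw [Complex.div_im]; ring
  have e3 : (r - q ^ 2 / p).im =
      (r.im * Complex.normSq p - 2 * q.re * q.im * p.re + (q.re ^ 2 - q.im ^ 2) * p.im) /
        Complex.normSq p := by
    rw [Complex.sub_im, Complex.div_im, pow_two q, Complex.mul_re, Complex.mul_im]
    field_simp
    ring
  refine ⟨by rw [e1]; positivity, ?_⟩
  rw [e1, e2, e3, div_pow, div_mul_div_comm, ← pow_two]
  refine (div_lt_div_iff_of_pos_right (by positivity)).2 ?_
  rw [hN']
  have : 0 < p.re ^ 2 + p.im ^ 2 := hN' ▸ hN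
  nlinarith [mul_pos this (sub_pos.2 hd)]

theorem tsum_thetaTerm_fst (p q r : ℂ) (a b c d n₂ : ℤ) :
    ∑' n₁ : ℤ, thetaTerm p q r a b c d (n₁, n₂) =
      Complex.exp (Real.pi * Complex.I * (p * a ^ 2 / 4 + q * a * (n₂ + b / 2) + a * c / 2 +
        r * (n₂ + b / 2) ^ 2 + (n₂ + b / 2) * d)) *
      jacobiTheta₂ (p * a / 2 + q * (n₂ + b / 2) + c / 2) p := by
  rw [jacobiTheta₂, ← tsum_mul_left]
  refine tsum_congr fun n₁ => ?_
  rw [thetaTerm, jacobiTheta₂_term, ← Complex.exp_add]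
  congr 1
  ring

theorem thetaSum_eq_tsum_jacobiTheta₂ {p q r : ℂ} (hp : 0 < p.im)
    (hd : q.im ^ 2 < p.im * r.im) (a b c d : ℤ) :
    thetaSum p q r a b c d = ∑' n₂ : ℤ,
      Complex.exp (Real.pi * Complex.I * (p * a ^ 2 / 4 + q * a * (n₂ + b / 2) + a * c / 2 +
        r * (n₂ + b / 2) ^ 2 + (n₂ + b / 2) * d)) *
      jacobiTheta₂ (p * a / 2 + q * (n₂ + b / 2) + c / 2) p := by
  rw [thetaSum, ← (Equiv.prodComm ℤ ℤ).tsum_eq]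
  refine (((Equiv.prodComm ℤ ℤ).summable_iff.2 (summable_thetaTerm hp hd a b c d)).tsum_prod).trans
    ?_
  exact tsum_congr fun n₂ => tsum_thetaTerm_fst p q r a b c d n₂

/-- For fixed `n₂` the sum over `n₁` is a Jacobi theta function, so the one-variable functional
equation suffices. Its Gaussian factor combines with the outer exponent and turns `r` into `r - q ^
2 / p`. -/
theorem thetaSum_partialInversion {p q r : ℂ} (hp : 0 < p.im)
    (hd : q.im ^ 2 < p.im * r.im) (a b c d : ℤ) :
    thetaSum p q r a b c d = 1 / (-Complex.I * p) ^ (1 / 2 : ℂ) *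
      Complex.exp (Real.pi * Complex.I * (a * c / 2)) *
      thetaSum (-1 / p) (q / p) (r - q ^ 2 / p) (-c) b a d := by
  have hp0 : p ≠ 0 := fun h => by simp [h] at hp
  obtain ⟨hp', hd'⟩ := partialInversion_im hp hd
  rw [thetaSum_eq_tsum_jacobiTheta₂ hp hd, thetaSum_eq_tsum_jacobiTheta₂ hp' hd', ← tsum_mul_left]
  refine tsum_congr fun n₂ => ?_
  rw [jacobiTheta₂_functional_equation]
  have hz : (-1 / p * ((-c : ℤ) : ℂ) / 2 + q / p * (n₂ + b / 2) + a / 2 : ℂ) =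
      (p * a / 2 + q * (n₂ + b / 2) + c / 2) / p := by
    push_cast
    field_simp
    ring
  rw [hz, ← mul_assoc, ← mul_assoc, mul_comm (Complex.exp _) (1 / _), mul_assoc (1 / _),
    ← Complex.exp_add, mul_assoc (1 / _), mul_assoc (1 / _), ← mul_assoc (Complex.exp _),
    ← Complex.exp_add]
  congr 3
  push_cast
  field_simp
  ring

theorem exists_norm_thetaSum_partialInversion {p q r : ℂ} (hp : 0 < p.im)
    (hd : q.im ^ 2 < p.im * r.im) : ∃ κ : ℝ, 0 < κ ∧ ∀ a b c d : ℤ,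
      ‖thetaSum (-1 / p) (q / p) (r - q ^ 2 / p) c b a d‖ = κ * ‖thetaSum p q r a b c d‖ := by
  have hp0 : p ≠ 0 := fun h => by simp [h] at hp
  have hne : (-Complex.I * p) ^ (1 / 2 : ℂ) ≠ 0 := by
    rw [Complex.cpow_def_of_ne_zero (by simp [hp0])]
    exact Complex.exp_ne_zero _
  refine ⟨‖(-Complex.I * p) ^ (1 / 2 : ℂ)‖, norm_pos_iff.2 hne, fun a b c d => ?_⟩
  rw [thetaSum_partialInversion hp hd, norm_mul, norm_mul, norm_div, norm_one, ← mul_assoc,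
    ← mul_assoc, mul_one_div_cancel (norm_ne_zero_iff.2 hne), one_mul,
    show (Real.pi * Complex.I * (a * c / 2) : ℂ) = Real.pi * Complex.I * ((2 * a * c : ℤ) / 4) by
      push_cast; ring, norm_exp_pi_mul_I_mul_int, one_mul]
  exact norm_thetaSum_congr _ _ _ (by rw [Int.modEq_iff_dvd]; omega) rfl rfl rfl

/-! ### Absolute values of theta constants, indexed by characteristics modulo two -/

/-- `|Θ_{m/2}(τ)|` for a characteristic `m` modulo two. -/
noncomputable def thetaAbs (τ : Matrix (Fin 2) (Fin 2) ℂ) (m : Fin 4 → ZMod 2) : ℝ :=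
  ‖thetaSum (τ 0 0) (τ 0 1) (τ 1 1) (m 0).val (m 1).val (m 2).val (m 3).val‖

theorem modEq_val_intCast (a : ℤ) : a ≡ ((a : ZMod 2).val : ℤ) [ZMOD 2] := by
  have := (ZMod.intCast_eq_intCast_iff a ((a : ZMod 2).val : ℤ) 2).1 (by simp)
  exact_mod_cast this

theorem norm_thetaSum_eq_thetaAbs (τ : Matrix (Fin 2) (Fin 2) ℂ) (a b c d : ℤ) :
    ‖thetaSum (τ 0 0) (τ 0 1) (τ 1 1) a b c d‖ =
      thetaAbs τ ![(a : ZMod 2), (b : ZMod 2), (c : ZMod 2), (d : ZMod 2)] :=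
  norm_thetaSum_congr _ _ _ (modEq_val_intCast a) (modEq_val_intCast b) (modEq_val_intCast c)
    (modEq_val_intCast d)

theorem exists_intCast_char (m : Fin 4 → ZMod 2) :
    ∃ a b c d : ℤ, m = ![(a : ZMod 2), (b : ZMod 2), (c : ZMod 2), (d : ZMod 2)] :=
  ⟨(m 0).val, (m 1).val, (m 2).val, (m 3).val, by ext i; fin_cases i <;> simp⟩

/-- The parity of a characteristic. -/
def charParity (m : Fin 4 → ZMod 2) : ZMod 2 := m 0 * m 2 + m 1 * m 3

/-- The absolute values of the theta constants at `τ` and `τ'` agree up to a positive factor and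
a parity-preserving permutation of the characteristics. -/
def ThetaEquivalent (τ τ' : Matrix (Fin 2) (Fin 2) ℂ) : Prop :=
  ∃ κ : ℝ, 0 < κ ∧ ∃ σ : Equiv.Perm (Fin 4 → ZMod 2),
    (∀ m, charParity (σ m) = charParity m) ∧ ∀ m, thetaAbs τ' (σ m) = κ * thetaAbs τ m

theorem ThetaEquivalent.trans {τ τ' τ'' : Matrix (Fin 2) (Fin 2) ℂ} (h : ThetaEquivalent τ τ')
    (h' : ThetaEquivalent τ' τ'') : ThetaEquivalent τ τ'' := by
  obtain ⟨κ, hκ, σ, hσ, hc⟩ := h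
  obtain ⟨κ', hκ', σ', hσ', hc'⟩ := h'
  exact ⟨κ' * κ, mul_pos hκ' hκ, σ.trans σ', fun m => by simp [hσ', hσ], fun m => by
    simp [hc', hc, mul_assoc]⟩

/-- `γ` acts on `ℋ₂`, changing the absolute values of theta constants only by a permutation and a
positive factor. -/
def PermutesThetas (γ : Matrix (Fin 2 ⊕ Fin 2) (Fin 2 ⊕ Fin 2) ℤ) : Prop :=
  ∀ τ ∈ siegelHalfSpace 2, (autFactor γ τ).det ≠ 0 ∧ siegelAct γ τ ∈ siegelHalfSpace 2 ∧
    ThetaEquivalent τ (siegelAct γ τ)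

/-- The numerator `A τ + B` of the action. -/
noncomputable def actNum (γ : Matrix (Fin 2 ⊕ Fin 2) (Fin 2 ⊕ Fin 2) ℤ)
    (τ : Matrix (Fin 2) (Fin 2) ℂ) : Matrix (Fin 2) (Fin 2) ℂ :=
  γ.toBlocks₁₁.map (Int.cast : ℤ → ℂ) * τ + γ.toBlocks₁₂.map (Int.cast : ℤ → ℂ)

theorem siegelAct_eq_of_mul_eq {γ : Matrix (Fin 2 ⊕ Fin 2) (Fin 2 ⊕ Fin 2) ℤ}
    {τ X : Matrix (Fin 2) (Fin 2) ℂ} (hdet : (autFactor γ τ).det ≠ 0)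
    (h : X * autFactor γ τ = actNum γ τ) : siegelAct γ τ = X := by
  rw [siegelAct, ← actNum, ← h, Matrix.mul_nonsing_inv_cancel_right _ _ hdet.isUnit]

theorem siegelAct_mul_autFactor {γ : Matrix (Fin 2 ⊕ Fin 2) (Fin 2 ⊕ Fin 2) ℤ}
    {τ : Matrix (Fin 2) (Fin 2) ℂ} (hdet : (autFactor γ τ).det ≠ 0) :
    siegelAct γ τ * autFactor γ τ = actNum γ τ := by
  rw [siegelAct, ← actNum, Matrix.nonsing_inv_mul_cancel_right _ _ hdet.isUnit]

theorem autFactor_mul {γ δ : Matrix (Fin 2 ⊕ Fin 2) (Fin 2 ⊕ Fin 2) ℤ}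
    {τ : Matrix (Fin 2) (Fin 2) ℂ} (hdet : (autFactor δ τ).det ≠ 0) :
    autFactor (γ * δ) τ = autFactor γ (siegelAct δ τ) * autFactor δ τ := by
  rw [autFactor.eq_1 γ, add_mul, mul_assoc, siegelAct_mul_autFactor hdet, actNum, autFactor,
    autFactor]
  ext i j
  fin_cases i <;> fin_cases j <;>
  · simp [Matrix.mul_apply, Fin.sum_univ_two, toBlocks₁₁, toBlocks₁₂, toBlocks₂₁, toBlocks₂₂]
    ring

theorem actNum_mul {γ δ : Matrix (Fin 2 ⊕ Fin 2) (Fin 2 ⊕ Fin 2) ℤ}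
    {τ : Matrix (Fin 2) (Fin 2) ℂ} (hdet : (autFactor δ τ).det ≠ 0) :
    actNum (γ * δ) τ = actNum γ (siegelAct δ τ) * autFactor δ τ := by
  rw [actNum.eq_1 γ, add_mul, mul_assoc, siegelAct_mul_autFactor hdet, actNum, actNum,
    autFactor]
  ext i j
  fin_cases i <;> fin_cases j <;>
  · simp [Matrix.mul_apply, Fin.sum_univ_two, toBlocks₁₁, toBlocks₁₂, toBlocks₂₁, toBlocks₂₂]
    ring

theorem PermutesThetas.mul {γ δ : Matrix (Fin 2 ⊕ Fin 2) (Fin 2 ⊕ Fin 2) ℤ}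
    (hγ : PermutesThetas γ) (hδ : PermutesThetas δ) : PermutesThetas (γ * δ) := by
  intro τ hτ
  obtain ⟨h1, h2, h3⟩ := hδ τ hτ
  obtain ⟨h4, h5, h6⟩ := hγ _ h2
  have hdet : (autFactor (γ * δ) τ).det ≠ 0 := by
    rw [autFactor_mul h1, det_mul]; exact mul_ne_zero h4 h1
  have hact : siegelAct (γ * δ) τ = siegelAct γ (siegelAct δ τ) := by
    refine siegelAct_eq_of_mul_eq hdet ?_
    rw [autFactor_mul h1, actNum_mul h1, ← mul_assoc, siegelAct_mul_autFactor h4]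
  rw [hact]
  exact ⟨hdet, h5, h3.trans h6⟩

/-! ### Generators -/

/-- The translation `τ ↦ τ + (s t; t u)`. -/
def translation (s t u : ℤ) : Matrix (Fin 2 ⊕ Fin 2) (Fin 2 ⊕ Fin 2) ℤ :=
  fromBlocks 1 !![s, t; t, u] 0 1

theorem permutesThetas_translation (s t u : ℤ) : PermutesThetas (translation s t u) := by
  intro τ hτ
  obtain ⟨h10, hp, hd⟩ := mem_siegelHalfSpace_two_iff.1 hτ
  have haut : autFactor (translation s t u) τ = 1 := by
    simp [autFactor, translation]
  have hact : siegelAct (translation s t u) τ =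
      !![τ 0 0 + s, τ 0 1 + t; τ 0 1 + t, τ 1 1 + u] := by
    refine siegelAct_eq_of_mul_eq (by simp [haut]) ?_
    rw [haut]
    ext i j
    fin_cases i <;> fin_cases j <;> simp [actNum, translation, h10]
  refine ⟨by simp [haut], ?_, ?_⟩
  · rw [hact, mem_siegelHalfSpace_two_iff]
    exact ⟨by simp, by simpa using hp, by simpa using hd⟩
  let f : (Fin 4 → ZMod 2) → Fin 4 → ZMod 2 := fun m =>
    ![m 0, m 1, m 2 + s * (1 + m 0) + t * m 1, m 3 + t * m 0 + u * (1 + m 1)]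
  have h2 : (2 : ZMod 2) = 0 := rfl
  have hf : Function.Involutive f := fun m => by
    ext i
    fin_cases i
    · rfl
    · rfl
    · simp [f]
      linear_combination (s * (1 + m 0) + t * m 1) * h2
    · simp [f]
      linear_combination (t * m 0 + u * (1 + m 1)) * h2
  refine ⟨1, one_pos, hf.toPerm, fun m => ?_, fun m => ?_⟩
  · have hx : ∀ x : ZMod 2, x * (1 + x) = 0 := by decide
    simp only [Function.Involutive.coe_toPerm, f, charParity, Matrix.cons_val]
    linear_combination s * hx (m 0) + u * hx (m 1) + t * m 0 * m 1 * h2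
  · conv_rhs => rw [← hf m]
    rw [one_mul, Function.Involutive.coe_toPerm]
    obtain ⟨a, b, c, d, hm⟩ := exists_intCast_char (f m)
    rw [hm, ← norm_thetaSum_eq_thetaAbs, hact]
    have := norm_thetaSum_translate (τ 0 0) (τ 0 1) (τ 1 1) a b c d s t u
    rw [norm_thetaSum_eq_thetaAbs τ] at this
    simpa [f] using this

/-- The element `τ ↦ A τ D⁻¹`. -/
def levi (A D : Matrix (Fin 2) (Fin 2) ℤ) : Matrix (Fin 2 ⊕ Fin 2) (Fin 2 ⊕ Fin 2) ℤ :=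
  fromBlocks A 0 0 D

theorem permutesThetas_levi {A D : Matrix (Fin 2) (Fin 2) ℤ} (hAD : Aᵀ * D = 1) :
    PermutesThetas (levi A D) := by
  intro τ hτ
  obtain ⟨h10, hp, hd⟩ := mem_siegelHalfSpace_two_iff.1 hτ
  have haut : autFactor (levi A D) τ = D.map (Int.cast : ℤ → ℂ) := by
    simp [autFactor, levi]
  have hADC : (A.map (Int.cast : ℤ → ℂ))ᵀ * D.map (Int.cast : ℤ → ℂ) = 1 := by
    have := Matrix.map_mul (L := Aᵀ) (M := D) (f := Int.castRingHom ℂ)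
    rw [hAD, Matrix.map_one _ (map_zero _) (map_one _)] at this
    exact this.symm
  have hdet : (autFactor (levi A D) τ).det ≠ 0 := by
    rw [haut]
    intro h0
    have := congrArg det hADC
    rw [det_mul, h0, mul_zero, det_one] at this
    exact zero_ne_one this
  have hact : siegelAct (levi A D) τ =
      A.map (Int.cast : ℤ → ℂ) * τ * (A.map (Int.cast : ℤ → ℂ))ᵀ := by
    refine siegelAct_eq_of_mul_eq hdet ?_
    rw [haut, mul_assoc, hADC, mul_one]
    simp [actNum, levi]
  have hδ : (A 0 0 * A 1 1 - A 0 1 * A 1 0) * D.det = 1 := by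
    have := congrArg det hAD
    rwa [det_mul, det_transpose, det_one, det_fin_two A] at this
  generalize D.det = δ at hδ
  obtain ⟨e, he⟩ : ∃ e, e = A 0 0 := ⟨_, rfl⟩
  obtain ⟨f, hf⟩ : ∃ f, f = A 0 1 := ⟨_, rfl⟩
  obtain ⟨g, hg⟩ : ∃ g, g = A 1 0 := ⟨_, rfl⟩
  obtain ⟨h, hh⟩ : ∃ h, h = A 1 1 := ⟨_, rfl⟩
  rw [← he, ← hf, ← hg, ← hh] at hδ
  have hact' : siegelAct (levi A D) τ =
      !![e ^ 2 * τ 0 0 + 2 * e * f * τ 0 1 + f ^ 2 * τ 1 1,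
          e * g * τ 0 0 + (e * h + f * g) * τ 0 1 + f * h * τ 1 1;
        e * g * τ 0 0 + (e * h + f * g) * τ 0 1 + f * h * τ 1 1,
          g ^ 2 * τ 0 0 + 2 * g * h * τ 0 1 + h ^ 2 * τ 1 1] := by
    rw [hact, he, hf, hg, hh]
    ext i j
    fin_cases i <;> fin_cases j <;>
    · simp [Matrix.mul_apply, Fin.sum_univ_two, h10]
      ring
  refine ⟨hdet, ?_, ?_⟩
  · have him : ∀ (x y z : ℤ), ((x : ℂ) * τ 0 0 + y * τ 0 1 + z * τ 1 1).im =
        x * (τ 0 0).im + y * (τ 0 1).im + z * (τ 1 1).im := fun x y z => by simp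
    have i1 := him (e ^ 2) (2 * e * f) (f ^ 2)
    have i2 := him (e * g) (e * h + f * g) (f * h)
    have i3 := him (g ^ 2) (2 * g * h) (h ^ 2)
    push_cast at i1 i2 i3
    rw [hact', mem_siegelHalfSpace_two_iff]
    simp only [of_apply, cons_val', cons_val_zero, cons_val_one, cons_val_fin_one, true_and]
    rw [i1, i2, i3]
    set p := (τ 0 0).im
    set q := (τ 0 1).im
    set r := (τ 1 1).im
    have hδR : ((e * h - f * g : ℝ)) * δ = 1 := by exact_mod_cast hδ
    constructor
    · refine pos_of_mul_pos_right (a := p) ?_ hp.le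
      rw [show p * ((e : ℝ) ^ 2 * p + 2 * e * f * q + f ^ 2 * r) =
        (e * p + f * q) ^ 2 + f ^ 2 * (p * r - q ^ 2) by ring]
      rcases eq_or_ne (f : ℝ) 0 with hf0 | hf0
      · have he0 : (e : ℝ) ≠ 0 := fun he0 => by simp [hf0, he0] at hδR
        rw [hf0]
        have : 0 < (e * p) ^ 2 := by positivity
        simpa using this
      · have : 0 < (f : ℝ) ^ 2 * (p * r - q ^ 2) := mul_pos (by positivity) (by linarith)
        positivity
    · have hne : (e * h - f * g : ℝ) ≠ 0 := fun h0 => by simp [h0] at hδR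
      have : 0 < (e * h - f * g : ℝ) ^ 2 * (p * r - q ^ 2) :=
        mul_pos (by positivity) (by linarith)
      linarith
  have hδ2 : ((e * h - f * g : ZMod 2)) * δ = 1 := by exact_mod_cast congrArg (Int.cast) hδ
  -- The two halves of the characteristic transform by contragredient matrices, so their pairing,
  -- which is the parity, is preserved.
  let σ : Equiv.Perm (Fin 4 → ZMod 2) :=
    { toFun := fun m => ![δ * (h * m 0 - g * m 1), δ * (e * m 1 - f * m 0),
        e * m 2 + f * m 3, g * m 2 + h * m 3]
      invFun := fun m => ![e * m 0 + g * m 1, f * m 0 + h * m 1,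
        δ * (h * m 2 - f * m 3), δ * (e * m 3 - g * m 2)]
      left_inv := fun m => by
        ext i
        fin_cases i <;> simp only [Fin.zero_eta, Fin.mk_one, Fin.reduceFinMk, Matrix.cons_val]
        · linear_combination m 0 * hδ2
        · linear_combination m 1 * hδ2
        · linear_combination m 2 * hδ2
        · linear_combination m 3 * hδ2
      right_inv := fun m => by
        ext i
        fin_cases i <;> simp only [Fin.zero_eta, Fin.mk_one, Fin.reduceFinMk, Matrix.cons_val]
        · linear_combination m 0 * hδ2
        · linear_combination m 1 * hδ2
        · linear_combination m 2 * hδ2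
        · linear_combination m 3 * hδ2 }
  refine ⟨1, one_pos, σ, fun m => ?_, fun m => ?_⟩
  · simp only [σ, charParity, Equiv.coe_fn_mk, Matrix.cons_val]
    linear_combination (m 0 * m 2 + m 1 * m 3) * hδ2
  · have hs := σ.symm_apply_apply m
    generalize σ m = m' at hs
    rw [one_mul, ← hs]
    have hsymm : σ.symm m' = ![e * m' 0 + g * m' 1, f * m' 0 + h * m' 1,
        δ * (h * m' 2 - f * m' 3), δ * (e * m' 3 - g * m' 2)] := rfl
    obtain ⟨a, b, c, d, hm⟩ := exists_intCast_char m'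
    -- The lower half is put in the form `(e x + f y, g x + h y)` with integers `x, y`, as required
    -- by `thetaSum_congr_unimodular`.
    have hm2 : m' = ![(a : ZMod 2), (b : ZMod 2),
        ((e * (δ * (h * c - f * d)) + f * (δ * (e * d - g * c)) : ℤ) : ZMod 2),
        ((g * (δ * (h * c - f * d)) + h * (δ * (e * d - g * c)) : ℤ) : ZMod 2)] := by
      rw [hm]
      ext i
      fin_cases i <;> simp only [Fin.zero_eta, Fin.mk_one, Fin.reduceFinMk, Matrix.cons_val] <;>
        push_cast
      · linear_combination -c * hδ2
      · linear_combination -d * hδ2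
    have hm3 : σ.symm m' = ![((e * a + g * b : ℤ) : ZMod 2), ((f * a + h * b : ℤ) : ZMod 2),
        ((δ * (h * c - f * d) : ℤ) : ZMod 2), ((δ * (e * d - g * c) : ℤ) : ZMod 2)] := by
      rw [hsymm, hm]
      push_cast
      rfl
    rw [hm3, hm2, ← norm_thetaSum_eq_thetaAbs, ← norm_thetaSum_eq_thetaAbs, hact',
      ← thetaSum_congr_unimodular _ _ _ hδ]
    simp

/-- The partial inversion in the first variable. -/
def partialInversion : Matrix (Fin 2 ⊕ Fin 2) (Fin 2 ⊕ Fin 2) ℤ :=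
  fromBlocks !![0, 0; 0, 1] !![-1, 0; 0, 0] !![1, 0; 0, 0] !![0, 0; 0, 1]

theorem autFactor_partialInversion (τ : Matrix (Fin 2) (Fin 2) ℂ) :
    autFactor partialInversion τ = !![τ 0 0, τ 0 1; 0, 1] := by
  ext i j
  fin_cases i <;> fin_cases j <;>
    simp [autFactor, partialInversion, Matrix.mul_apply, Fin.sum_univ_two]

theorem permutesThetas_partialInversion : PermutesThetas partialInversion := by
  intro τ hτ
  obtain ⟨h10, hp, hd⟩ := mem_siegelHalfSpace_two_iff.1 hτ
  have hp0 : τ 0 0 ≠ 0 := fun h => by simp [h] at hp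
  have hdet : (autFactor partialInversion τ).det ≠ 0 := by
    rw [autFactor_partialInversion, det_fin_two_of]
    simpa using hp0
  have hact : siegelAct partialInversion τ = !![-1 / τ 0 0, τ 0 1 / τ 0 0; τ 0 1 / τ 0 0,
      τ 1 1 - τ 0 1 ^ 2 / τ 0 0] := by
    refine siegelAct_eq_of_mul_eq hdet ?_
    rw [autFactor_partialInversion]
    ext i j
    fin_cases i <;> fin_cases j <;>
      simp [actNum, partialInversion, Matrix.mul_apply, Fin.sum_univ_two, h10] <;>
      field_simp <;> ring
  refine ⟨hdet, ?_, ?_⟩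
  · rw [hact, mem_siegelHalfSpace_two_iff]
    simpa using partialInversion_im hp hd
  obtain ⟨κ, hκ, hc⟩ := exists_norm_thetaSum_partialInversion hp hd
  let f : (Fin 4 → ZMod 2) → Fin 4 → ZMod 2 := fun m => ![m 2, m 1, m 0, m 3]
  have hf : Function.Involutive f := fun m => by
    ext i
    fin_cases i <;> rfl
  refine ⟨κ, hκ, hf.toPerm, fun m => ?_, fun m => ?_⟩
  · simp only [Function.Involutive.coe_toPerm, f, charParity, Matrix.cons_val]
    ring
  · obtain ⟨a, b, c, d, rfl⟩ := exists_intCast_char m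
    rw [← norm_thetaSum_eq_thetaAbs, ← hc, hact, Function.Involutive.coe_toPerm]
    simp only [f, Matrix.cons_val]
    rw [← norm_thetaSum_eq_thetaAbs]
    rfl

/-! ### Generation of the symplectic group -/

/-- The embedding of `SL₂` acting on the first variable. -/
def embedFst (M : SpecialLinearGroup (Fin 2) ℤ) : Matrix (Fin 2 ⊕ Fin 2) (Fin 2 ⊕ Fin 2) ℤ :=
  fromBlocks !![M 0 0, 0; 0, 1] !![M 0 1, 0; 0, 0] !![M 1 0, 0; 0, 0] !![M 1 1, 0; 0, 1]

theorem embedFst_one : embedFst 1 = 1 := by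
  rw [embedFst, ← fromBlocks_one]
  congr 1 <;> ext i j <;> fin_cases i <;> fin_cases j <;> simp

theorem embedFst_mul (M N : SpecialLinearGroup (Fin 2) ℤ) :
    embedFst (M * N) = embedFst M * embedFst N := by
  rw [embedFst, embedFst, embedFst, fromBlocks_multiply]
  congr 1 <;> ext i j <;> fin_cases i <;> fin_cases j <;>
    simp [Matrix.mul_apply, Fin.sum_univ_two]

theorem embedFst_mem (M : SpecialLinearGroup (Fin 2) ℤ) :
    embedFst M ∈ symplecticGroup (Fin 2) ℤ := by
  have hdet := M.2
  rw [det_fin_two] at hdet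
  rw [embedFst, SymplecticGroup.fromBlocks_mem_iff]
  refine ⟨?_, ?_, ?_⟩ <;> ext i j <;> fin_cases i <;> fin_cases j <;>
    simp [Matrix.mul_apply, Fin.sum_univ_two, mul_comm]
  linarith

theorem permutesThetas_one : PermutesThetas 1 := by
  have : (1 : Matrix (Fin 2 ⊕ Fin 2) (Fin 2 ⊕ Fin 2) ℤ) = levi 1 1 := by simp [levi]
  rw [this]
  exact permutesThetas_levi (by simp)

theorem permutesThetas_embedFst (M : SpecialLinearGroup (Fin 2) ℤ) :
    PermutesThetas (embedFst M) := by
  have hM : M ∈ Subgroup.closure {ModularGroup.S, ModularGroup.T} := by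
    rw [SpecialLinearGroup.SL2Z_generators]; trivial
  have hS : embedFst ModularGroup.S = partialInversion := by
    simp [embedFst, partialInversion, ModularGroup.S]
  have hT (s : ℤ) (hs : s = 1 ∨ s = -1) : PermutesThetas (embedFst (ModularGroup.T ^ s)) := by
    have : embedFst (ModularGroup.T ^ s) = translation s 0 0 := by
      rw [embedFst, translation, ModularGroup.coe_T_zpow]
      congr 1 <;> ext i j <;> fin_cases i <;> fin_cases j <;> simp
    rw [this]
    exact permutesThetas_translation _ _ _
  -- Inverses are carried along in the induction because `PermutesThetas` is not visibly closed
  -- under inversion.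
  suffices PermutesThetas (embedFst M) ∧ PermutesThetas (embedFst M⁻¹) from this.1
  induction hM using Subgroup.closure_induction with
  | mem x hx =>
    rcases hx with rfl | rfl
    · have h1 : PermutesThetas (embedFst ModularGroup.S) :=
        hS ▸ permutesThetas_partialInversion
      have h3 : (ModularGroup.S)⁻¹ = ModularGroup.S * ModularGroup.S * ModularGroup.S := by
        decide
      exact ⟨h1, by rw [h3, embedFst_mul, embedFst_mul]; exact (h1.mul h1).mul h1⟩
    · exact ⟨by simpa using hT 1 (.inl rfl), by simpa using hT (-1) (.inr rfl)⟩
  | one => simpa [embedFst_one] using permutesThetas_one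
  | mul x y _ _ hx hy =>
    rw [_root_.mul_inv_rev, embedFst_mul, embedFst_mul]
    exact ⟨hx.1.mul hy.1, hy.2.mul hx.2⟩
  | inv x _ hx => simpa using hx.symm

theorem PermutesThetas.of_embedFst_mul {γ : Matrix (Fin 2 ⊕ Fin 2) (Fin 2 ⊕ Fin 2) ℤ}
    (M : SpecialLinearGroup (Fin 2) ℤ) (h : PermutesThetas (embedFst M * γ)) :
    PermutesThetas γ := by
  have := (permutesThetas_embedFst M⁻¹).mul h
  rwa [← mul_assoc, ← embedFst_mul, inv_mul_cancel, embedFst_one, one_mul] at this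

theorem levi_mem {A D : Matrix (Fin 2) (Fin 2) ℤ} (hAD : Aᵀ * D = 1) :
    levi A D ∈ symplecticGroup (Fin 2) ℤ := by
  rw [levi, SymplecticGroup.fromBlocks_mem_iff]
  simp [hAD]

theorem PermutesThetas.of_levi_mul {γ : Matrix (Fin 2 ⊕ Fin 2) (Fin 2 ⊕ Fin 2) ℤ}
    {A D : Matrix (Fin 2) (Fin 2) ℤ} (hAD : Aᵀ * D = 1) (h : PermutesThetas (levi A D * γ)) :
    PermutesThetas γ := by
  have hDA : Dᵀ * A = 1 := by simpa using congrArg transpose hAD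
  have h1 : levi Dᵀ Aᵀ * levi A D = 1 := by
    simp [levi, fromBlocks_multiply, hAD, hDA]
  have := (permutesThetas_levi (A := Dᵀ) (D := Aᵀ)
    (by simpa using mul_eq_one_comm.1 hAD)).mul h
  rwa [← mul_assoc, h1, one_mul] at this

/-- The lower row is `(-c', a')`, where `(a', c')` is `(a, c)` divided by its gcd; coprimality lets
it be completed. -/
theorem exists_specialLinearGroup_annihilating (a c : ℤ) :
    ∃ M : SpecialLinearGroup (Fin 2) ℤ, M 1 0 * a + M 1 1 * c = 0 := by
  rcases eq_or_ne (Int.gcd a c) 0 with h | h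
  · rw [Int.gcd_eq_zero_iff] at h
    exact ⟨1, by simp [h.1, h.2]⟩
  · obtain ⟨a', c', hco, ha, hc⟩ := Int.exists_gcd_one (Nat.pos_of_ne_zero h)
    have : IsCoprime (-c') a' := by
      rw [IsCoprime.neg_left_iff]; exact (Int.isCoprime_iff_gcd_eq_one.2 hco).symm
    obtain ⟨M, h1, h2⟩ := this.exists_SL2_row 1
    refine ⟨M, ?_⟩
    rw [h1, h2]
    linear_combination a' * hc - c' * ha

/-- Such an element is a translation by the symmetric matrix `B Aᵀ` times a Levi element. -/
theorem permutesThetas_of_toBlocks₂₁_eq_zero {A B D : Matrix (Fin 2) (Fin 2) ℤ}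
    (hγ : fromBlocks A B 0 D ∈ symplecticGroup (Fin 2) ℤ) :
    PermutesThetas (fromBlocks A B 0 D) := by
  obtain ⟨-, hBD, hAD⟩ := SymplecticGroup.fromBlocks_mem_iff.1 hγ
  rw [transpose_zero, zero_mul, sub_zero] at hAD
  have hDA : D * Aᵀ = 1 := mul_eq_one_comm.1 hAD
  have hAD' : A * Dᵀ = 1 := by simpa using congrArg transpose hDA
  have hsymm : A * Bᵀ = B * Aᵀ := by
    calc A * Bᵀ = A * (Bᵀ * D) * Aᵀ := by rw [mul_assoc, mul_assoc, hDA, mul_one]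
      _ = B * Aᵀ := by rw [hBD, ← mul_assoc, hAD', one_mul]
  have hS : B * Aᵀ = !![(B * Aᵀ) 0 0, (B * Aᵀ) 0 1; (B * Aᵀ) 0 1, (B * Aᵀ) 1 1] := by
    have ht : (B * Aᵀ)ᵀ = B * Aᵀ := by rw [transpose_mul, transpose_transpose, hsymm]
    have h10 : (B * Aᵀ) 1 0 = (B * Aᵀ) 0 1 := congrFun (congrFun ht 0) 1
    ext i j
    fin_cases i <;> fin_cases j <;> simp [h10]
  have : fromBlocks A B 0 D =
      translation ((B * Aᵀ) 0 0) ((B * Aᵀ) 0 1) ((B * Aᵀ) 1 1) * levi A D := by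
    rw [translation, ← hS, levi, fromBlocks_multiply]
    simp [mul_assoc, hAD]
  rw [this]
  exact (permutesThetas_translation _ _ _).mul (permutesThetas_levi hAD)

open Sum in
theorem permutesThetas_of_lower_left_aux₁ {γ : Matrix (Fin 2 ⊕ Fin 2) (Fin 2 ⊕ Fin 2) ℤ}
    (hγ : γ ∈ symplecticGroup (Fin 2) ℤ) (hA : γ (inl 0) (inl 0) = 0)
    (h00 : γ (inr 0) (inl 0) = 0) (h10 : γ (inr 1) (inl 0) = 0) (h11 : γ (inr 1) (inl 1) = 0) :
    PermutesThetas γ := by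
  obtain ⟨M, hM⟩ := exists_specialLinearGroup_annihilating (γ (inl 0) (inl 1)) (γ (inr 0) (inl 1))
  refine .of_embedFst_mul M ?_
  have hmem := mul_mem (embedFst_mem M) hγ
  have hC : (embedFst M * γ).toBlocks₂₁ = 0 := by
    ext i j
    fin_cases i <;> fin_cases j <;>
      simp [toBlocks₂₁, embedFst, Matrix.mul_apply, Fin.sum_univ_two, hA, h00, h10, h11, hM]
  rw [← fromBlocks_toBlocks (embedFst M * γ), hC] at hmem ⊢
  exact permutesThetas_of_toBlocks₂₁_eq_zero hmem

theorem swap_transpose_mul_swap :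
    (!![0, 1; 1, 0] : Matrix (Fin 2) (Fin 2) ℤ)ᵀ * !![0, 1; 1, 0] = 1 := by decide

open Sum in
theorem permutesThetas_of_lower_left_aux₂ {γ : Matrix (Fin 2 ⊕ Fin 2) (Fin 2 ⊕ Fin 2) ℤ}
    (hγ : γ ∈ symplecticGroup (Fin 2) ℤ) (hA : γ (inl 1) (inl 0) = 0)
    (h00 : γ (inr 0) (inl 0) = 0) (h10 : γ (inr 1) (inl 0) = 0) :
    PermutesThetas γ := by
  -- The symplectic relations reduce to `A₀₀ D₀₀ = 1` and `A₀₀ C₀₁ = 0`.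
  have h01 : γ (inr 0) (inl 1) = 0 := by
    have h := hγ
    rw [← fromBlocks_toBlocks γ] at h
    obtain ⟨hAC, -, hAD⟩ := SymplecticGroup.fromBlocks_mem_iff.1 h
    have e1 := congrFun (congrFun hAC 0) 1
    have e2 := congrFun (congrFun hAD 0) 0
    simp [toBlocks₁₁, toBlocks₁₂, toBlocks₂₁, toBlocks₂₂, Matrix.mul_apply, Fin.sum_univ_two,
      hA, h00, h10] at e1 e2
    rcases e1 with e1 | e1
    · simp [e1] at e2
    · exact e1
  refine .of_levi_mul swap_transpose_mul_swap
    (permutesThetas_of_lower_left_aux₁ (mul_mem (levi_mem swap_transpose_mul_swap) hγ)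
      ?_ ?_ ?_ ?_) <;>
    simp [levi, Matrix.mul_apply, Fin.sum_univ_two, hA, h00, h10, h01]

open Sum in
theorem permutesThetas_of_lower_left_aux₃ {γ : Matrix (Fin 2 ⊕ Fin 2) (Fin 2 ⊕ Fin 2) ℤ}
    (hγ : γ ∈ symplecticGroup (Fin 2) ℤ)
    (h00 : γ (inr 0) (inl 0) = 0) (h10 : γ (inr 1) (inl 0) = 0) :
    PermutesThetas γ := by
  obtain ⟨M, hM⟩ := exists_specialLinearGroup_annihilating (γ (inl 0) (inl 0)) (γ (inl 1) (inl 0))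
  have hAD : M.1ᵀ * (M⁻¹).1ᵀ = 1 := by
    rw [← transpose_mul]
    have : (M⁻¹).1 * M.1 = 1 := congrArg Subtype.val (inv_mul_cancel M)
    rw [this, transpose_one]
  refine .of_levi_mul hAD (permutesThetas_of_lower_left_aux₂ (mul_mem (levi_mem hAD) hγ)
    ?_ ?_ ?_) <;>
    simp [levi, Matrix.mul_apply, Fin.sum_univ_two, h00, h10, hM]

open Sum in
theorem permutesThetas_of_lower_left_aux₄ {γ : Matrix (Fin 2 ⊕ Fin 2) (Fin 2 ⊕ Fin 2) ℤ}
    (hγ : γ ∈ symplecticGroup (Fin 2) ℤ) (h10 : γ (inr 1) (inl 0) = 0) :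
    PermutesThetas γ := by
  obtain ⟨M, hM⟩ := exists_specialLinearGroup_annihilating (γ (inl 0) (inl 0)) (γ (inr 0) (inl 0))
  refine .of_embedFst_mul M (permutesThetas_of_lower_left_aux₃ (mul_mem (embedFst_mem M) hγ)
    ?_ ?_) <;>
    simp [embedFst, Matrix.mul_apply, Fin.sum_univ_two, h10, hM]

open Sum in
-- Elimination by left multiplication: `SL₂` in the first variable clears an entry in row 0 of `C`,
-- and the swap of variables brings the other row there. Once the first column of `C` is zero, a
-- Levi element clears the entry of `A` below `A₀₀`; the symplectic relations then leave a single
-- entry of `C` to remove.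
theorem permutesThetas_of_mem_symplecticGroup {γ : Matrix (Fin 2 ⊕ Fin 2) (Fin 2 ⊕ Fin 2) ℤ}
    (hγ : γ ∈ symplecticGroup (Fin 2) ℤ) : PermutesThetas γ := by
  obtain ⟨M, hM⟩ := exists_specialLinearGroup_annihilating (γ (inl 0) (inl 0)) (γ (inr 0) (inl 0))
  refine .of_embedFst_mul M (.of_levi_mul swap_transpose_mul_swap
    (permutesThetas_of_lower_left_aux₄ (mul_mem (levi_mem swap_transpose_mul_swap)
      (mul_mem (embedFst_mem M) hγ)) ?_))
  simp [levi, embedFst, Matrix.mul_apply, Fin.sum_univ_two, hM]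

/-! ### The duplication formula and quartic relations -/

/-- The change of variables `(κ, (k, l)) ↦ (k + l + κ, k - l)` on pairs of lattice points. -/
def parityEquiv : (Fin 2 × Fin 2) × ((ℤ × ℤ) × (ℤ × ℤ)) ≃ (ℤ × ℤ) × (ℤ × ℤ) where
  toFun w := ((w.2.1.1 + w.2.2.1 + w.1.1.val, w.2.1.2 + w.2.2.2 + w.1.2.val),
    (w.2.1.1 - w.2.2.1, w.2.1.2 - w.2.2.2))
  invFun z := ((⟨((z.1.1 - z.2.1) % 2).toNat, by omega⟩, ⟨((z.1.2 - z.2.2) % 2).toNat, by omega⟩),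
    (((z.1.1 + z.2.1 - (z.1.1 - z.2.1) % 2) / 2, (z.1.2 + z.2.2 - (z.1.2 - z.2.2) % 2) / 2),
      ((z.1.1 - z.2.1 - (z.1.1 - z.2.1) % 2) / 2, (z.1.2 - z.2.2 - (z.1.2 - z.2.2) % 2) / 2)))
  left_inv w := by
    obtain ⟨⟨κ, μ⟩, ⟨⟨k, k'⟩, ⟨l, l'⟩⟩⟩ := w
    have := κ.2
    have := μ.2
    ext <;> simp only <;> omega
  right_inv z := by
    obtain ⟨⟨n, n'⟩, ⟨m, m'⟩⟩ := z
    ext <;> simp only <;> omega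

/-- Parallelogram law: half-sum and half-difference of the two shifted lattice points are `k + (κ +
a) / 2` and `l + κ / 2`, and the form doubles. -/
theorem thetaTerm_mul_thetaTerm (p q r : ℂ) (a b c d : ℤ)
    (w : (Fin 2 × Fin 2) × ((ℤ × ℤ) × (ℤ × ℤ))) :
    thetaTerm p q r a b c d (parityEquiv w).1 * thetaTerm p q r a b c d (parityEquiv w).2 =
      (-1) ^ (((w.1.1.val : ℤ) + a) * c + ((w.1.2.val : ℤ) + b) * d) *
        (thetaTerm (2 * p) (2 * q) (2 * r) (w.1.1.val + a) (w.1.2.val + b) 0 0 w.2.1 *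
          thetaTerm (2 * p) (2 * q) (2 * r) w.1.1.val w.1.2.val 0 0 w.2.2) := by
  obtain ⟨⟨κ, μ⟩, ⟨⟨k, k'⟩, ⟨l, l'⟩⟩⟩ := w
  have h1 : (-1 : ℂ) ^ (((κ.val : ℤ) + a) * c + ((μ.val : ℤ) + b) * d) =
      Complex.exp (Real.pi * Complex.I * (((κ.val : ℤ) + a) * c + ((μ.val : ℤ) + b) * d : ℤ)) := by
    rw [← Complex.exp_pi_mul_I, ← Complex.exp_int_mul]
    congr 1
    ring
  rw [h1, ← one_mul (Complex.exp _), ← exp_pi_mul_I_mul_two_mul_int (k * c + k' * d)]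
  simp only [thetaTerm, parityEquiv, Equiv.coe_fn_mk, ← Complex.exp_add]
  congr 1
  push_cast
  ring

theorem thetaSum_sq {p q r : ℂ} (hp : 0 < p.im) (hd : q.im ^ 2 < p.im * r.im) (a b c d : ℤ) :
    thetaSum p q r a b c d ^ 2 = ∑ κ : Fin 2 × Fin 2,
      (-1) ^ (((κ.1.val : ℤ) + a) * c + ((κ.2.val : ℤ) + b) * d) *
        (thetaSum (2 * p) (2 * q) (2 * r) (κ.1.val + a) (κ.2.val + b) 0 0 *
          thetaSum (2 * p) (2 * q) (2 * r) κ.1.val κ.2.val 0 0) := by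
  have hp' : 0 < (2 * p).im := by simpa using hp
  have hd' : (2 * q).im ^ 2 < (2 * p).im * (2 * r).im := by
    simp only [Complex.mul_im, Complex.re_ofNat, Complex.im_ofNat, zero_mul, add_zero]
    linarith
  have hs := summable_norm_thetaTerm hp hd a b c d
  rw [pow_two, thetaSum, tsum_mul_tsum_of_summable_norm hs hs, ← parityEquiv.tsum_eq]
  have hs' := (parityEquiv.summable_iff.2 (summable_mul_of_summable_norm hs hs))
  refine hs'.tsum_prod.trans ?_
  rw [tsum_fintype]
  refine Finset.sum_congr rfl fun κ _ => ?_
  rw [thetaSum, thetaSum, tsum_mul_tsum_of_summable_norm (summable_norm_thetaTerm hp' hd' _ _ _ _)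
    (summable_norm_thetaTerm hp' hd' _ _ _ _), ← tsum_mul_left]
  exact tsum_congr fun z => thetaTerm_mul_thetaTerm p q r a b c d (κ, z)

/-- The ten even theta constants, in the order of `evenChars`. -/
noncomputable def evenTheta (p q r : ℂ) : Fin 10 → ℂ :=
  ![thetaSum p q r 0 0 0 0, thetaSum p q r 0 0 0 1, thetaSum p q r 0 0 1 0,
    thetaSum p q r 0 0 1 1, thetaSum p q r 0 1 0 0, thetaSum p q r 0 1 1 0,
    thetaSum p q r 1 0 0 0, thetaSum p q r 1 0 0 1, thetaSum p q r 1 1 0 0,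
    thetaSum p q r 1 1 1 1]

theorem evenTheta_sq {p q r : ℂ} (hp : 0 < p.im) (hd : q.im ^ 2 < p.im * r.im) :
    ∃ A B C D : ℂ, ∀ i, evenTheta p q r i ^ 2 =
      ![A ^ 2 + B ^ 2 + C ^ 2 + D ^ 2, A ^ 2 - B ^ 2 + C ^ 2 - D ^ 2,
        A ^ 2 + B ^ 2 - C ^ 2 - D ^ 2, A ^ 2 - B ^ 2 - C ^ 2 + D ^ 2,
        2 * (A * B + C * D), 2 * (A * B - C * D), 2 * (A * C + B * D), 2 * (A * C - B * D),
        2 * (A * D + B * C), 2 * (A * D - B * C)] i := by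
  refine ⟨thetaSum (2 * p) (2 * q) (2 * r) 0 0 0 0, thetaSum (2 * p) (2 * q) (2 * r) 0 1 0 0,
    thetaSum (2 * p) (2 * q) (2 * r) 1 0 0 0, thetaSum (2 * p) (2 * q) (2 * r) 1 1 0 0,
    fun i => ?_⟩
  -- The entries `κ + a` of the duplication formula can equal 2 and are reduced to 0.
  have h02 := thetaSum_add_two_left (2 * p) (2 * q) (2 * r) 0 0 0 0 0 1
  have h20 := thetaSum_add_two_left (2 * p) (2 * q) (2 * r) 0 0 0 0 1 0
  have h22 := thetaSum_add_two_left (2 * p) (2 * q) (2 * r) 0 0 0 0 1 1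
  have h12 := thetaSum_add_two_left (2 * p) (2 * q) (2 * r) 1 0 0 0 0 1
  have h21 := thetaSum_add_two_left (2 * p) (2 * q) (2 * r) 0 1 0 0 1 0
  norm_num at h02 h20 h22 h12 h21
  fin_cases i <;> simp [evenTheta, thetaSum_sq hp hd, Fintype.sum_prod_type, Fin.sum_univ_two] <;>
    norm_num [h02, h20, h22, h12, h21] <;> ring

/-- The coefficients of the fifteen four-term linear relations between the fourth powers of the
even theta constants. -/
def quarticRelation : Fin 15 → Fin 10 → ℤ :=
  ![![1, -1, 0, 0, -1, 0, 0, 0, 0, -1], ![1, -1, 0, 0, 0, -1, 0, 0, -1, 0],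
    ![1, 0, -1, 0, 0, 0, -1, 0, 0, -1], ![1, 0, -1, 0, 0, 0, 0, -1, -1, 0],
    ![1, 0, 0, -1, -1, 0, 0, -1, 0, 0], ![1, 0, 0, -1, 0, -1, -1, 0, 0, 0],
    ![0, 1, -1, 0, 1, 0, -1, 0, 0, 0], ![0, 1, -1, 0, 0, 1, 0, -1, 0, 0],
    ![0, 1, 0, -1, 0, 0, -1, 0, 1, 0], ![0, 1, 0, -1, 0, 0, 0, -1, 0, 1],
    ![0, 0, 1, -1, -1, 0, 0, 0, 1, 0], ![0, 0, 1, -1, 0, -1, 0, 0, 0, 1],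
    ![0, 0, 0, 0, 1, -1, -1, 1, 0, 0], ![0, 0, 0, 0, 1, -1, 0, 0, -1, 1],
    ![0, 0, 0, 0, 0, 0, 1, -1, -1, 1]]

/-- After substituting the squares, each relation is a polynomial identity in `A, B, C, D`. -/
theorem sum_quarticRelation {p q r : ℂ} (hp : 0 < p.im) (hd : q.im ^ 2 < p.im * r.im)
    (s : Fin 15) : ∑ j, (quarticRelation s j : ℂ) * evenTheta p q r j ^ 4 = 0 := by
  obtain ⟨A, B, C, D, h⟩ := evenTheta_sq hp hd
  have h4 (j : Fin 10) : evenTheta p q r j ^ 4 = (evenTheta p q r j ^ 2) ^ 2 := by ring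
  simp only [h4, h]
  fin_cases s <;> simp [quarticRelation, Fin.sum_univ_succ] <;> ring

theorem abs_quarticRelation_le (s : Fin 15) (j : Fin 10) : |quarticRelation s j| ≤ 1 := by
  revert s j; decide

/-- For each even characteristic, three of the relations involving it which have nothing else in
common. -/
def disjointRelations : Fin 10 → Fin 3 → Fin 15 :=
  ![![0, 3, 5], ![0, 7, 8], ![2, 7, 10], ![4, 8, 11], ![0, 10, 12], ![1, 11, 12], ![2, 8, 12],
    ![3, 9, 12], ![1, 10, 14], ![0, 11, 14]]

theorem abs_quarticRelation_disjointRelations (i : Fin 10) (s : Fin 3) :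
    |quarticRelation (disjointRelations i s) i| = 1 := by
  revert i s; decide

theorem disjointRelations_disjoint (i : Fin 10) (s t : Fin 3) (j : Fin 10) (hj : j ≠ i)
    (hs : quarticRelation (disjointRelations i s) j ≠ 0)
    (ht : quarticRelation (disjointRelations i t) j ≠ 0) : s = t := by
  revert i s t j; decide

theorem card_support_disjointRelations (i : Fin 10) (s : Fin 3) :
    (Finset.univ.filter fun j => j ≠ i ∧
      quarticRelation (disjointRelations i s) j ≠ 0).card = 3 := by
  revert i s; decide

/-! ### Part (a): four large theta constants -/

theorem exists_large_of_disjointRelations {p q r : ℂ} (hp : 0 < p.im)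
    (hd : q.im ^ 2 < p.im * r.im) {c : ℝ} (hc : 3 * c ^ 4 < 1) (i : Fin 10)
    (s : Fin 3) (hi : evenTheta p q r i ≠ 0) :
    ∃ j ≠ i, quarticRelation (disjointRelations i s) j ≠ 0 ∧
      c * ‖evenTheta p q r i‖ ≤ ‖evenTheta p q r j‖ := by
  set R := quarticRelation (disjointRelations i s)
  set v := evenTheta p q r
  by_contra! hcon
  have hsum := sum_quarticRelation hp hd (disjointRelations i s)
  rw [← Finset.add_sum_erase _ _ (Finset.mem_univ i)] at hsum
  have h1 : ‖v i‖ ^ 4 ≤ ∑ j ∈ Finset.univ.erase i, ‖(R j : ℂ) * v j ^ 4‖ := by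
    have hR : ‖(R i : ℂ)‖ = 1 := by
      rw [Complex.norm_intCast]
      exact_mod_cast abs_quarticRelation_disjointRelations i s
    calc ‖v i‖ ^ 4 = ‖(R i : ℂ) * v i ^ 4‖ := by rw [norm_mul, hR, one_mul, norm_pow]
      _ = ‖∑ j ∈ Finset.univ.erase i, (R j : ℂ) * v j ^ 4‖ := by
        rw [eq_neg_of_add_eq_zero_left hsum, norm_neg]
      _ ≤ _ := norm_sum_le _ _
  have h2 : ∑ j ∈ Finset.univ.erase i, ‖(R j : ℂ) * v j ^ 4‖ ≤
      ∑ j ∈ Finset.univ.filter (fun j => j ≠ i ∧ R j ≠ 0), (c * ‖v i‖) ^ 4 := by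
    rw [show (Finset.univ.filter fun j => j ≠ i ∧ R j ≠ 0) =
      (Finset.univ.erase i).filter fun j => R j ≠ 0 by ext; simp, Finset.sum_filter]
    refine Finset.sum_le_sum fun j hj => ?_
    have hji : j ≠ i := (Finset.mem_erase.1 hj).1
    split_ifs with hRj
    · rw [norm_mul, norm_pow, Complex.norm_intCast]
      have hR : |(R j : ℝ)| ≤ 1 := by exact_mod_cast abs_quarticRelation_le _ j
      calc |(R j : ℝ)| * ‖v j‖ ^ 4 ≤ 1 * ‖v j‖ ^ 4 := by gcongr
        _ = ‖v j‖ ^ 4 := one_mul _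
        _ ≤ (c * ‖v i‖) ^ 4 := by gcongr; exact (hcon j hji hRj).le
    · simp [not_not.1 hRj]
  rw [Finset.sum_const, card_support_disjointRelations] at h2
  have h3 : 0 < ‖v i‖ ^ 4 := by positivity
  have h4 : ‖v i‖ ^ 4 ≤ 3 * c ^ 4 * ‖v i‖ ^ 4 := by
    calc _ ≤ _ := h1.trans h2
      _ = _ := by rw [nsmul_eq_mul, mul_pow]; push_cast; ring
  nlinarith

/-- The ten even characteristics, in the order of `evenChars`. -/
def evenChar : Fin 10 → Fin 4 → ℕ :=
  ![![0, 0, 0, 0], ![0, 0, 0, 1], ![0, 0, 1, 0], ![0, 0, 1, 1], ![0, 1, 0, 0],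
    ![0, 1, 1, 0], ![1, 0, 0, 0], ![1, 0, 0, 1], ![1, 1, 0, 0], ![1, 1, 1, 1]]

theorem evenChar_injective : Function.Injective evenChar := by decide

theorem image_evenChar : Finset.univ.image evenChar = evenChars := by decide

theorem thetaConst_evenChar {τ : Matrix (Fin 2) (Fin 2) ℂ} (h : τ 1 0 = τ 0 1) (i : Fin 10) :
    thetaConst (evenChar i) τ = evenTheta (τ 0 0) (τ 0 1) (τ 1 1) i := by
  rw [thetaConst_eq_thetaSum h]
  fin_cases i <;> simp [evenChar, evenTheta]

theorem card_filter_evenChars (P : (Fin 4 → ℕ) → Prop) [DecidablePred P] :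
    (evenChars.filter P).card = (Finset.univ.filter fun i => P (evenChar i)).card := by
  rw [← image_evenChar, Finset.filter_image, Finset.card_image_of_injective _ evenChar_injective]

theorem exists_norm_thetaConst_eq_max (τ : Matrix (Fin 2) (Fin 2) ℂ) :
    ∃ i, ‖thetaConst (evenChar i) τ‖ = maxThetaConst τ := by
  obtain ⟨m, hm, h⟩ := Finset.exists_mem_eq_sup' evenChars_nonempty fun m => ‖thetaConst m τ‖
  rw [← image_evenChar] at hm
  obtain ⟨i, -, rfl⟩ := Finset.mem_image.1 hm
  exact ⟨i, h.symm⟩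

theorem card_small_theta_le_six {τ : Matrix (Fin 2) (Fin 2) ℂ} (hτ : τ ∈ siegelHalfSpace 2)
    {c : ℝ} (hc : 3 * c ^ 4 < 1) :
    (evenChars.filter fun m => ‖thetaConst m τ‖ < c * maxThetaConst τ).card ≤ 6 := by
  obtain ⟨h10, hp, hd⟩ := mem_siegelHalfSpace_two_iff.1 hτ
  obtain ⟨i, hi⟩ := exists_norm_thetaConst_eq_max τ
  rw [card_filter_evenChars, ← hi]
  simp only [thetaConst_evenChar h10]
  set v := evenTheta (τ 0 0) (τ 0 1) (τ 1 1)
  rcases eq_or_ne (v i) 0 with h0 | h0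
  · simp [h0, (norm_nonneg _).not_gt]
  choose j hji hRj hj using
    fun s => exists_large_of_disjointRelations hp hd hc i s h0
  have hinj : Function.Injective j := fun s t hst =>
    disjointRelations_disjoint i s t (j s) (hji s) (hRj s) (hst ▸ hRj t)
  -- Needed so that the maximal theta constant itself counts as large.
  have hc1 : c ≤ 1 := by
    by_contra! h
    have : 1 < c ^ 4 := one_lt_pow₀ h (by norm_num)
    linarith
  have hsub : insert i (Finset.univ.image j) ⊆
      Finset.univ.filter fun k => ¬ ‖v k‖ < c * ‖v i‖ := by
    intro k hk
    simp only [Finset.mem_insert, Finset.mem_image, Finset.mem_univ, true_and] at hk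
    simp only [Finset.mem_filter, Finset.mem_univ, true_and, not_lt]
    rcases hk with rfl | ⟨s, rfl⟩
    · exact mul_le_of_le_one_left (norm_nonneg _) hc1
    · exact hj s
  have h4 := Finset.card_le_card hsub
  rw [Finset.card_insert_of_notMem (by simpa using hji), Finset.card_image_of_injective _ hinj,
    Finset.card_univ, Fintype.card_fin] at h4
  have h5 := Finset.card_filter_add_card_filter_not (s := (Finset.univ : Finset (Fin 10)))
    (fun k => ‖v k‖ < c * ‖v i‖)
  rw [Finset.card_univ, Fintype.card_fin] at h5
  omega

/-! ### Invariance of the number of small theta constants -/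

theorem norm_thetaConst_evenChar_eq_thetaAbs {τ : Matrix (Fin 2) (Fin 2) ℂ} (h : τ 1 0 = τ 0 1)
    (i : Fin 10) : ‖thetaConst (evenChar i) τ‖ = thetaAbs τ fun k => (evenChar i k : ZMod 2) := by
  rw [thetaConst_eq_thetaSum h, norm_thetaSum_eq_thetaAbs]
  congr 1
  ext k
  fin_cases k <;> simp

theorem charParity_evenChar (i : Fin 10) : charParity (fun k => (evenChar i k : ZMod 2)) = 0 := by
  revert i; decide

theorem exists_evenChar_eq {m : Fin 4 → ZMod 2} (hm : charParity m = 0) :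
    ∃ i, (fun k => (evenChar i k : ZMod 2)) = m := by
  revert m; decide

theorem evenChar_cast_injective :
    Function.Injective fun (i : Fin 10) (k : Fin 4) => (evenChar i k : ZMod 2) := by decide

theorem norm_thetaConst_le_max (τ : Matrix (Fin 2) (Fin 2) ℂ) (i : Fin 10) :
    ‖thetaConst (evenChar i) τ‖ ≤ maxThetaConst τ :=
  Finset.le_sup' (fun m => ‖thetaConst m τ‖)
    (by rw [← image_evenChar]; exact Finset.mem_image_of_mem _ (Finset.mem_univ i))

/-- Every small characteristic at `τ` is sent by the permutation to the single exceptional `i₀`, so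
injectivity leaves at most one. -/
theorem ThetaEquivalent.card_small_le_one {τ τ' : Matrix (Fin 2) (Fin 2) ℂ}
    (h : ThetaEquivalent τ τ') (hτ : τ 1 0 = τ 0 1) (hτ' : τ' 1 0 = τ' 0 1) {c : ℝ} (hc : 0 ≤ c)
    (i₀ : Fin 10)
    (hlarge : ∀ i ≠ i₀, c * maxThetaConst τ' ≤ ‖thetaConst (evenChar i) τ'‖) :
    (evenChars.filter fun m => ‖thetaConst m τ‖ < c * maxThetaConst τ).card ≤ 1 := by
  obtain ⟨κ, hκ, σ, hpar, hσ⟩ := h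
  have htrans (i : Fin 10) : ∃ j, σ (fun k => (evenChar i k : ZMod 2)) =
      (fun k => (evenChar j k : ZMod 2)) ∧
      ‖thetaConst (evenChar j) τ'‖ = κ * ‖thetaConst (evenChar i) τ‖ := by
    obtain ⟨j, hj⟩ := exists_evenChar_eq ((hpar _).trans (charParity_evenChar i))
    exact ⟨j, hj.symm, by rw [norm_thetaConst_evenChar_eq_thetaAbs hτ', hj, hσ,
      norm_thetaConst_evenChar_eq_thetaAbs hτ]⟩
  have hmax : κ * maxThetaConst τ ≤ maxThetaConst τ' := by
    obtain ⟨i, hi⟩ := exists_norm_thetaConst_eq_max τ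
    obtain ⟨j, -, hj⟩ := htrans i
    rw [← hi, ← hj]
    exact norm_thetaConst_le_max τ' j
  have hsmall (i : Fin 10) (hi : ‖thetaConst (evenChar i) τ‖ < c * maxThetaConst τ) :
      σ (fun k => (evenChar i k : ZMod 2)) = fun k => (evenChar i₀ k : ZMod 2) := by
    obtain ⟨j, hj, hj'⟩ := htrans i
    by_contra hne
    have hji : j ≠ i₀ := fun hji => hne (hji ▸ hj)
    have h1 := hlarge j hji
    have h2 : κ * ‖thetaConst (evenChar i) τ‖ < κ * (c * maxThetaConst τ) := by gcongr
    have h3 : c * (κ * maxThetaConst τ) ≤ c * maxThetaConst τ' := by gcongr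
    linarith
  rw [card_filter_evenChars, Finset.card_le_one]
  intro i hi j hj
  simp only [Finset.mem_filter, Finset.mem_univ, true_and] at hi hj
  exact evenChar_cast_injective (σ.injective ((hsmall i hi).trans (hsmall j hj).symm))

/-! ### Majorization of theta series by geometric series -/

/-- The domination is asked only off `S`, since the majorants used below may be smaller than the
leading terms. -/
theorem norm_sub_sum_le_of_hasSum {β : Type*} {f : β → ℂ} {g : β → ℝ} {a : ℂ} {b : ℝ}
    (S : Finset β) (hf : HasSum f a) (hg : HasSum g b) (hb : ∀ n ∉ S, ‖f n‖ ≤ g n) :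
    ‖a - ∑ n ∈ S, f n‖ ≤ b - ∑ n ∈ S, g n := by
  have hf' : HasSum (fun n : {n // n ∉ S} => f n) (a - ∑ n ∈ S, f n) :=
    S.hasSum_compl_iff.2 (by rwa [sub_add_cancel])
  have hg' : HasSum (fun n : {n // n ∉ S} => g n) (b - ∑ n ∈ S, g n) :=
    S.hasSum_compl_iff.2 (by rwa [sub_add_cancel])
  rw [← hf'.tsum_eq]
  exact tsum_of_norm_bounded hg' fun n => hb n n.2

theorem norm_tsum_sub_sum_le {f : ℤ × ℤ → ℂ} {K₁ K₂ : ℤ → ℝ} {s₁ s₂ C : ℝ} (S : Finset (ℤ × ℤ))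
    (h₁ : HasSum K₁ s₁) (h₂ : HasSum K₂ s₂) (hK₁ : ∀ n, 0 ≤ K₁ n) (hK₂ : ∀ n, 0 ≤ K₂ n)
    (hf : Summable f) (hb : ∀ n ∉ S, ‖f n‖ ≤ C * (K₁ n.1 * K₂ n.2)) :
    ‖∑' n, f n - ∑ n ∈ S, f n‖ ≤ C * (s₁ * s₂ - ∑ n ∈ S, K₁ n.1 * K₂ n.2) := by
  have hs : HasSum (fun n : ℤ × ℤ => K₁ n.1 * K₂ n.2) (s₁ * s₂) :=
    h₁.mul h₂ (h₁.summable.mul_of_nonneg h₂.summable hK₁ hK₂)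
  rw [mul_sub, Finset.mul_sum]
  exact norm_sub_sum_le_of_hasSum S hf.hasSum (hs.mul_left C) hb

theorem hasSum_geometric_natAbs {x : ℝ} (h0 : 0 ≤ x) (h1 : x < 1) :
    HasSum (fun n : ℤ => x ^ n.natAbs) ((1 + x) / (1 - x)) := by
  have h := hasSum_geometric_of_lt_one h0 h1
  have hneg : HasSum (fun n : ℕ => x ^ (-((n : ℤ) + 1)).natAbs) (x * (1 - x)⁻¹) := by
    have hn (n : ℕ) : x ^ (-((n : ℤ) + 1)).natAbs = x * x ^ n := by
      rw [show (-((n : ℤ) + 1)).natAbs = n + 1 by omega, pow_succ']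
    simpa only [hn] using h.mul_left x
  have hpos : HasSum (fun n : ℕ => x ^ (n : ℤ).natAbs) (1 - x)⁻¹ := by simpa using h
  convert HasSum.of_nat_of_neg_add_one (f := fun n : ℤ => x ^ n.natAbs) hpos hneg using 1
  ring

/-- Because of truncated subtraction the exponent is 0 at `n = 0` as well as at `n = ±1`. -/
theorem hasSum_geometric_natAbs_sub_one {x : ℝ} (h0 : 0 ≤ x) (h1 : x < 1) :
    HasSum (fun n : ℤ => x ^ (n.natAbs - 1)) (1 + 2 / (1 - x)) := by
  have h := hasSum_geometric_of_lt_one h0 h1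
  have hpos : HasSum (fun n : ℕ => x ^ ((n : ℤ).natAbs - 1)) (1 + (1 - x)⁻¹) := by
    have := (hasSum_nat_add_iff (f := fun n : ℕ => x ^ ((n : ℤ).natAbs - 1)) (g := (1 - x)⁻¹) 1).1
      (by
        have hn (n : ℕ) : ((n + 1 : ℕ) : ℤ).natAbs - 1 = n := by omega
        simpa only [hn] using h)
    simpa [add_comm] using this
  have hneg : HasSum (fun n : ℕ => x ^ ((-((n : ℤ) + 1)).natAbs - 1)) (1 - x)⁻¹ := by
    convert h using 3 with n
    omega
  convert HasSum.of_nat_of_neg_add_one (f := fun n : ℤ => x ^ (n.natAbs - 1)) hpos hneg using 1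
  ring

/-- For `n : ℤ`, the natural number `j` with `|n + 1/2| = j + 1/2`. -/
def halfIndex (n : ℤ) : ℕ := if 0 ≤ n then n.toNat else (-n - 1).toNat

theorem abs_add_half (n : ℤ) : |(n : ℝ) + 1 / 2| = halfIndex n + 1 / 2 := by
  rw [halfIndex]
  split_ifs with h
  · have h' : (0 : ℝ) ≤ n := by exact_mod_cast h
    have e : ((n.toNat : ℤ) : ℝ) = n := by rw [Int.toNat_of_nonneg h]
    rw [abs_of_nonneg (by linarith), ← e, Int.cast_natCast]
  · have h' : (n : ℝ) ≤ -1 := by exact_mod_cast (by omega : n ≤ -1)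
    have e : (((-n - 1).toNat : ℤ) : ℝ) = -n - 1 := by
      rw [Int.toNat_of_nonneg (by omega)]; push_cast; ring
    rw [abs_of_nonpos (by linarith), ← Int.cast_natCast (-n - 1).toNat, e]
    ring

theorem hasSum_geometric_halfIndex {x : ℝ} (h0 : 0 ≤ x) (h1 : x < 1) :
    HasSum (fun n : ℤ => x ^ halfIndex n) (2 / (1 - x)) := by
  have h := hasSum_geometric_of_lt_one h0 h1
  have hn (n : ℕ) : halfIndex (-((n : ℤ) + 1)) = n := by
    rw [halfIndex, if_neg (by omega)]; omega
  have hpos : HasSum (fun n : ℕ => x ^ halfIndex n) (1 - x)⁻¹ := by simpa [halfIndex] using h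
  have hneg : HasSum (fun n : ℕ => x ^ halfIndex (-((n : ℤ) + 1))) (1 - x)⁻¹ := by
    simpa only [hn] using h
  convert HasSum.of_nat_of_neg_add_one (f := fun n : ℤ => x ^ halfIndex n) hpos hneg using 1
  ring

theorem exp_neg_pi_le_mul_pow {Q L α β : ℝ} {j k : ℕ} (h : L + α * j + β * k ≤ Q) :
    Real.exp (-Real.pi * Q) ≤ Real.exp (-Real.pi * L) *
      (Real.exp (-Real.pi * α) ^ j * Real.exp (-Real.pi * β) ^ k) := by
  rw [← Real.exp_nat_mul, ← Real.exp_nat_mul, ← Real.exp_add, ← Real.exp_add, Real.exp_le_exp]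
  linarith [mul_le_mul_of_nonneg_left h Real.pi_pos.le]

theorem exp_neg_pi_lt_one {y : ℝ} (hy : 0 < y) : Real.exp (-Real.pi * y) < 1 := by
  rw [Real.exp_lt_one_iff]
  linarith [mul_pos Real.pi_pos hy]

/-- For `q ≥ 0` the worst case is a negative cross term. -/
theorem binForm_ge {p q r : ℝ} (hq0 : 0 ≤ q) (x₁ x₂ : ℝ) :
    p * |x₁| ^ 2 - 2 * q * (|x₁| * |x₂|) + r * |x₂| ^ 2 ≤ binForm p q r x₁ x₂ := by
  rw [sq_abs, sq_abs, binForm, ← abs_mul]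
  nlinarith [neg_abs_le (x₁ * x₂)]

theorem binForm_lattice_ge {p q r y : ℝ} (hy : 0 < y) (hp : y ≤ p) (hr : y ≤ r) (hq0 : 0 ≤ q)
    (hq : 2 * q ≤ y) {n : ℤ × ℤ} (hn : n ≠ 0) :
    y + y * (n.1.natAbs - 1 : ℕ) + y * (n.2.natAbs - 1 : ℕ) ≤ binForm p q r n.1 n.2 := by
  have h := binForm_ge (p := p) (r := r) hq0 n.1 n.2
  have e (m : ℤ) : |(m : ℝ)| = m.natAbs := by rw [Nat.cast_natAbs, Int.cast_abs]
  rw [e, e] at h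
  refine le_trans ?_ h
  have h0 : n.1.natAbs ≠ 0 ∨ n.2.natAbs ≠ 0 := by
    by_contra! h0
    exact hn (Prod.ext (Int.natAbs_eq_zero.1 h0.1) (Int.natAbs_eq_zero.1 h0.2))
  generalize n.1.natAbs = a at *
  generalize n.2.natAbs = b at *
  -- Replacing `p`, `r` and `2 q` by `y` leaves this inequality between natural numbers; the
  -- truncated differences make the case of a zero coordinate separate.
  have key : 1 + ((a - 1 : ℕ) : ℝ) + ((b - 1 : ℕ) : ℝ) ≤ a ^ 2 - a * b + b ^ 2 := by
    rcases a with _ | a <;> rcases b with _ | b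
    · simp at h0
    · push_cast
      simp
      nlinarith [(Nat.cast_nonneg b : (0 : ℝ) ≤ b)]
    · push_cast
      simp
      nlinarith [(Nat.cast_nonneg a : (0 : ℝ) ≤ a)]
    · push_cast
      nlinarith [sq_nonneg ((a : ℝ) - b), sq_nonneg (a : ℝ), sq_nonneg (b : ℝ)]
  have h1 := mul_le_mul_of_nonneg_left key hy.le
  have h2 : 0 ≤ (p - y) * (a : ℝ) ^ 2 := mul_nonneg (by linarith) (by positivity)
  have h3 : 0 ≤ (r - y) * (b : ℝ) ^ 2 := mul_nonneg (by linarith) (by positivity)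
  have h4 : 0 ≤ (y - 2 * q) * ((a : ℝ) * b) := mul_nonneg (by linarith) (by positivity)
  linarith

theorem binForm_half_int_ge {p q r y : ℝ} (hy : 0 < y) (hp : y ≤ p) (hr : y ≤ r) (hq0 : 0 ≤ q)
    (hq : 2 * q ≤ y) (n : ℤ × ℤ) :
    p / 4 + y * halfIndex n.1 + y / 2 * n.2.natAbs ≤ binForm p q r (n.1 + 1 / 2) n.2 := by
  have h := binForm_ge (p := p) (r := r) hq0 (n.1 + 1 / 2) n.2
  have e (m : ℤ) : |(m : ℝ)| = m.natAbs := by rw [Nat.cast_natAbs, Int.cast_abs]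
  rw [e, abs_add_half] at h
  refine le_trans ?_ h
  generalize halfIndex n.1 = j at *
  generalize n.2.natAbs = a at *
  -- For `a = 1` this is `j ≤ j ^ 2`, which uses that `j` is an integer.
  have key : (a : ℝ) + j * a ≤ a ^ 2 + j ^ 2 := by
    rcases a with _ | _ | a
    · simp
    · have : (j : ℤ) ≤ j ^ 2 := by nlinarith [Int.le_self_sq j]
      have : (j : ℝ) ≤ j ^ 2 := by exact_mod_cast this
      push_cast
      linarith
    · push_cast
      nlinarith [sq_nonneg (2 * (j : ℝ) - (a + 2)), (Nat.cast_nonneg a : (0 : ℝ) ≤ a)]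
  have h1 := mul_le_mul_of_nonneg_left key hy.le
  have h2 : 0 ≤ (p - y) * ((j : ℝ) ^ 2 + j) := mul_nonneg (by linarith) (by positivity)
  have h3 : 0 ≤ (r - y) * (a : ℝ) ^ 2 := mul_nonneg (by linarith) (by positivity)
  have h4 : 0 ≤ (y - 2 * q) * (((j : ℝ) + 1 / 2) * a) := mul_nonneg (by linarith) (by positivity)
  linarith

theorem binForm_half_half_ge {p q r y : ℝ} (hy : 0 < y) (hp : y ≤ p) (hr : y ≤ r) (hq0 : 0 ≤ q)
    (hq : 2 * q ≤ y) (n : ℤ × ℤ) :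
    (p - 2 * q + r) / 4 + y * halfIndex n.1 + y * halfIndex n.2 ≤
      binForm p q r (n.1 + 1 / 2) (n.2 + 1 / 2) := by
  have h := binForm_ge (p := p) (r := r) hq0 (n.1 + 1 / 2) (n.2 + 1 / 2)
  rw [abs_add_half, abs_add_half] at h
  refine le_trans ?_ h
  have sq_ge (m : ℕ) : (m : ℝ) ≤ m ^ 2 := by
    have : (m : ℤ) ≤ m ^ 2 := Int.le_self_sq m
    exact_mod_cast this
  generalize halfIndex n.1 = j at *
  generalize halfIndex n.2 = k at *
  have key : ((j : ℝ) + k) / 2 + j * k ≤ j ^ 2 + k ^ 2 := by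
    nlinarith [sq_ge j, sq_ge k, sq_nonneg ((j : ℝ) - k)]
  have h1 := mul_le_mul_of_nonneg_left key hy.le
  have h2 : 0 ≤ (p - y) * ((j : ℝ) ^ 2 + j) := mul_nonneg (by linarith) (by positivity)
  have h3 : 0 ≤ (r - y) * ((k : ℝ) ^ 2 + k) := mul_nonneg (by linarith) (by positivity)
  have h4 : 0 ≤ (y - 2 * q) * ((j : ℝ) * k + (j + k) / 2) :=
    mul_nonneg (by linarith) (by positivity)
  linarith

theorem im_sq_lt {p q r : ℂ} {y : ℝ} (hy : 0 < y) (hp : y ≤ p.im) (hr : y ≤ r.im)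
    (hq0 : 0 ≤ q.im) (hq : 2 * q.im ≤ y) : q.im ^ 2 < p.im * r.im := by
  nlinarith [mul_le_mul hp hr hy.le (by linarith)]

section Estimates

variable {p q r : ℂ} {y : ℝ}

theorem norm_thetaSum_sub_one_le (hy : 0 < y) (hp : y ≤ p.im) (hr : y ≤ r.im) (hq0 : 0 ≤ q.im)
    (hq : 2 * q.im ≤ y) (c d : ℤ) {w : ℝ} (hw : w = Real.exp (-Real.pi * y)) :
    ‖thetaSum p q r 0 0 c d - 1‖ ≤ w * ((1 + 2 / (1 - w)) * (1 + 2 / (1 - w)) - 1) := by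
  have hw0 : 0 ≤ w := hw ▸ (Real.exp_pos _).le
  have hK := hasSum_geometric_natAbs_sub_one hw0 (hw ▸ exp_neg_pi_lt_one hy)
  have h := norm_tsum_sub_sum_le (f := thetaTerm p q r 0 0 c d) (C := w) {0} hK hK
    (fun _ => by positivity) (fun _ => by positivity)
    (summable_thetaTerm (by linarith) (im_sq_lt hy hp hr hq0 hq) _ _ _ _) fun n hn => by
      rw [norm_thetaTerm, hw]
      refine exp_neg_pi_le_mul_pow ?_
      simpa using binForm_lattice_ge hy hp hr hq0 hq (by simpa using hn)
  simpa [thetaTerm, thetaSum] using h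

/-- The parameter `y` bounds both diagonal entries from below, with no order between them, so the
estimate also serves `(0 1 c 0)` after swapping the variables. -/
theorem norm_thetaSum_one_zero_sub_le (hy : 0 < y) (hp : y ≤ p.im) (hr : y ≤ r.im)
    (hq0 : 0 ≤ q.im) (hq : 2 * q.im ≤ y) (d : ℤ) {w ρ : ℝ} (hw : w = Real.exp (-Real.pi * y))
    (hρ : ρ = Real.exp (-Real.pi * (y / 2))) :
    ‖thetaSum p q r 1 0 0 d - 2 * Complex.exp (Real.pi * Complex.I * (p / 4))‖ ≤
      Real.exp (-Real.pi * (p.im / 4)) * (2 / (1 - w) * ((1 + ρ) / (1 - ρ)) - 2) := by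
  have hw0 : 0 ≤ w := hw ▸ (Real.exp_pos _).le
  have hρ0 : 0 ≤ ρ := hρ ▸ (Real.exp_pos _).le
  have h := norm_tsum_sub_sum_le (f := thetaTerm p q r 1 0 0 d)
    (C := Real.exp (-Real.pi * (p.im / 4))) {(0, 0), (-1, 0)}
    (hasSum_geometric_halfIndex hw0 (hw ▸ exp_neg_pi_lt_one hy))
    (hasSum_geometric_natAbs hρ0 (hρ ▸ exp_neg_pi_lt_one (half_pos hy)))
    (fun _ => by positivity) (fun _ => by positivity)
    (summable_thetaTerm (by linarith) (im_sq_lt hy hp hr hq0 hq) _ _ _ _) fun n _ => by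
      rw [norm_thetaTerm, hw, hρ]
      refine exp_neg_pi_le_mul_pow ?_
      simpa using binForm_half_int_ge hy hp hr hq0 hq n
  rw [Finset.sum_pair (by simp), Finset.sum_pair (by simp)] at h
  have e1 : thetaTerm p q r 1 0 0 d (0, 0) = Complex.exp (Real.pi * Complex.I * (p / 4)) := by
    rw [thetaTerm]; congr 1; push_cast; ring
  have e2 : thetaTerm p q r 1 0 0 d (-1, 0) = Complex.exp (Real.pi * Complex.I * (p / 4)) := by
    rw [thetaTerm]; congr 1; push_cast; ring
  rw [e1, e2, ← two_mul] at h
  refine h.trans (le_of_eq ?_)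
  simp [halfIndex]
  norm_num

theorem thetaSum_swap (p q r : ℂ) (a b c d : ℤ) :
    thetaSum r q p b a d c = thetaSum p q r a b c d := by
  have h := thetaSum_congr_unimodular p q r (e := 0) (f := 1) (g := 1) (h := 0) (δ := -1)
    (by norm_num) b a c d
  simpa using h

theorem norm_thetaSum_one_one_le (hy : 0 < y) (hp : y ≤ p.im) (hr : y ≤ r.im)
    (hq0 : 0 ≤ q.im) (hq : 2 * q.im ≤ y) (c d : ℤ) {w : ℝ} (hw : w = Real.exp (-Real.pi * y)) :
    ‖thetaSum p q r 1 1 c d‖ ≤ Real.exp (-Real.pi * ((p.im - 2 * q.im + r.im) / 4)) *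
      (2 / (1 - w) * (2 / (1 - w))) := by
  have hw0 : 0 ≤ w := hw ▸ (Real.exp_pos _).le
  have hK := hasSum_geometric_halfIndex hw0 (hw ▸ exp_neg_pi_lt_one hy)
  have h := norm_tsum_sub_sum_le (f := thetaTerm p q r 1 1 c d)
    (C := Real.exp (-Real.pi * ((p.im - 2 * q.im + r.im) / 4))) ∅ hK hK
    (fun _ => by positivity) (fun _ => by positivity)
    (summable_thetaTerm (by linarith) (im_sq_lt hy hp hr hq0 hq) _ _ _ _) fun n _ => by
      rw [norm_thetaTerm, hw]
      refine exp_neg_pi_le_mul_pow ?_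
      simpa using binForm_half_half_ge hy hp hr hq0 hq n
  simpa [thetaSum] using h

/-- The leading part comes from the four points `(±1/2, ±1/2)`: equal signs carry the extra factor
`exp (π i q)`. For `(1111)` the last factor would be `1 - exp (π i q)`, which has no positive lower
bound. -/
theorem norm_thetaSum_one_one_sub_le (hy : 0 < y) (hp : y ≤ p.im) (hr : y ≤ r.im)
    (hq0 : 0 ≤ q.im) (hq : 2 * q.im ≤ y) {w : ℝ} (hw : w = Real.exp (-Real.pi * y)) :
    ‖thetaSum p q r 1 1 0 0 - 2 * Complex.exp (Real.pi * Complex.I * ((p - 2 * q + r) / 4)) *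
        (1 + Complex.exp (Real.pi * Complex.I * q))‖ ≤
      Real.exp (-Real.pi * ((p.im - 2 * q.im + r.im) / 4)) *
        (2 / (1 - w) * (2 / (1 - w)) - 4) := by
  have hw0 : 0 ≤ w := hw ▸ (Real.exp_pos _).le
  have hK := hasSum_geometric_halfIndex hw0 (hw ▸ exp_neg_pi_lt_one hy)
  have h := norm_tsum_sub_sum_le (f := thetaTerm p q r 1 1 0 0)
    (C := Real.exp (-Real.pi * ((p.im - 2 * q.im + r.im) / 4)))
    {(0, 0), (-1, -1), (0, -1), (-1, 0)} hK hK
    (fun _ => by positivity) (fun _ => by positivity)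
    (summable_thetaTerm (by linarith) (im_sq_lt hy hp hr hq0 hq) _ _ _ _) fun n _ => by
      rw [norm_thetaTerm, hw]
      refine exp_neg_pi_le_mul_pow ?_
      simpa using binForm_half_half_ge hy hp hr hq0 hq n
  rw [Finset.sum_insert (by simp), Finset.sum_insert (by simp), Finset.sum_pair (by simp),
    Finset.sum_insert (by simp), Finset.sum_insert (by simp), Finset.sum_pair (by simp)] at h
  have e1 : thetaTerm p q r 1 1 0 0 (0, 0) =
      Complex.exp (Real.pi * Complex.I * ((p - 2 * q + r) / 4)) *
        Complex.exp (Real.pi * Complex.I * q) := by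
    rw [thetaTerm, ← Complex.exp_add]; congr 1; push_cast; ring
  have e2 : thetaTerm p q r 1 1 0 0 (-1, -1) =
      Complex.exp (Real.pi * Complex.I * ((p - 2 * q + r) / 4)) *
        Complex.exp (Real.pi * Complex.I * q) := by
    rw [thetaTerm, ← Complex.exp_add]; congr 1; push_cast; ring
  have e3 : thetaTerm p q r 1 1 0 0 (0, -1) =
      Complex.exp (Real.pi * Complex.I * ((p - 2 * q + r) / 4)) := by
    rw [thetaTerm]; congr 1; push_cast; ring
  have e4 : thetaTerm p q r 1 1 0 0 (-1, 0) =
      Complex.exp (Real.pi * Complex.I * ((p - 2 * q + r) / 4)) := by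
    rw [thetaTerm]; congr 1; push_cast; ring
  rw [e1, e2, e3, e4] at h
  refine le_trans (le_of_eq ?_) (h.trans (le_of_eq ?_))
  · rw [thetaSum]
    congr 1
    ring
  · simp [halfIndex]
    norm_num

end Estimates

/-! ### Theta constants on the fundamental domain -/

/-- The automorphy factor of the partial inversion has determinant `τ₀₀`, so `|τ₀₀| ≥ 1` while its
real part is at most `1/2` in absolute value. -/
theorem sqrt_three_div_two_le_im_of_mem_fundamentalDomain {τ : Matrix (Fin 2) (Fin 2) ℂ}
    (hτ : τ ∈ fundamentalDomain) : Real.sqrt 3 / 2 ≤ (τ 0 0).im := by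
  obtain ⟨hH, hre, -, hdet⟩ := hτ
  have hp := (mem_siegelHalfSpace_two_iff.1 hH).2.1
  have hmem : partialInversion ∈ symplecticGroup (Fin 2) ℤ := by
    rw [partialInversion, SymplecticGroup.fromBlocks_mem_iff]
    decide
  have h1 := hdet _ hmem
  rw [autFactor_partialInversion, det_fin_two_of, mul_one, mul_zero, sub_zero] at h1
  have h2 : 1 ≤ ‖τ 0 0‖ ^ 2 := one_le_pow₀ h1
  rw [← Complex.normSq_eq_norm_sq, Complex.normSq_apply] at h2
  have h3 := abs_le.1 (hre 0 0)
  rw [div_le_iff₀ two_pos, Real.sqrt_le_left (by linarith)]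
  nlinarith

theorem exp_neg_pi_div_four_le {y : ℝ} (hy : Real.sqrt 3 / 2 ≤ y) :
    Real.exp (-Real.pi * (y / 4)) ≤ 0.5067 := by
  -- The bound `0.5067` rounds up `exp (-π √3 / 8) ≈ 0.5065`.
  have hs : (1.732 : ℝ) ≤ Real.sqrt 3 := Real.le_sqrt_of_sq_le (by norm_num)
  have h1 : (0.68 : ℝ) ≤ Real.pi * (y / 4) := by nlinarith [Real.pi_gt_d4]
  have h2 : (1.9737 : ℝ) ≤ Real.exp 0.68 := by
    refine le_trans ?_ (Real.sum_le_exp_of_nonneg (by norm_num) 8)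
    norm_num [Finset.sum_range_succ, Nat.factorial]
  rw [neg_mul, Real.exp_neg, inv_le_comm₀ (Real.exp_pos _) (by norm_num)]
  refine le_trans ?_ (h2.trans (Real.exp_le_exp.2 h1))
  norm_num

theorem norm_cexp_pi_mul_I_mul (z : ℂ) :
    ‖Complex.exp (Real.pi * Complex.I * z)‖ = Real.exp (-Real.pi * z.im) := by
  rw [Complex.norm_exp, mul_assoc, Complex.re_ofReal_mul, Complex.I_mul_re]
  congr 1
  ring

/-- The exponential has argument `π Re z`, at most a right angle, hence nonnegative real part. -/
theorem one_le_norm_one_add_exp {z : ℂ} (hz : |z.re| ≤ 1 / 2) :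
    1 ≤ ‖1 + Complex.exp (Real.pi * Complex.I * z)‖ := by
  refine le_trans ?_ (Complex.re_le_norm _)
  rw [Complex.add_re, Complex.one_re, Complex.exp_re]
  have hi : (Real.pi * Complex.I * z : ℂ).im = Real.pi * z.re := by
    rw [mul_assoc, Complex.im_ofReal_mul, Complex.I_mul_im]
  have hc : 0 ≤ Real.cos (Real.pi * z.re) := by
    obtain ⟨h1, h2⟩ := abs_le.1 hz
    refine Real.cos_nonneg_of_mem_Icc ⟨?_, ?_⟩ <;> nlinarith [Real.pi_pos]
  rw [hi]
  have := mul_nonneg (Real.exp_pos (Real.pi * Complex.I * z : ℂ).re).le hc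
  linarith

/-! ### Numerical estimates for reduced matrices -/

section Reduced

variable {p q r : ℂ}

theorem geometric_bounds {ε : ℝ} (h0 : 0 ≤ ε) (h : ε ≤ 0.5067) :
    1 / (1 - ε ^ 4) ≤ 1.0706 ∧ (1 + ε ^ 2) / (1 - ε ^ 2) ≤ 1.691 ∧ 1 ≤ 1 / (1 - ε ^ 4) ∧
      1 ≤ (1 + ε ^ 2) / (1 - ε ^ 2) ∧ ε ^ 4 ≤ 0.06592 := by
  have h2 : ε ^ 2 ≤ 0.5067 ^ 2 := by gcongr
  have h4 : ε ^ 4 ≤ 0.5067 ^ 4 := by gcongr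
  have h20 : 0 ≤ ε ^ 2 := by positivity
  have h40 : 0 ≤ ε ^ 4 := by positivity
  norm_num at h2 h4
  refine ⟨?_, ?_, ?_, ?_, by linarith⟩
  · rw [div_le_iff₀ (by linarith)]; linarith
  · rw [div_le_iff₀ (by linarith)]; linarith
  · rw [le_div_iff₀ (by linarith)]; linarith
  · rw [le_div_iff₀ (by linarith)]; linarith

theorem exp_neg_pi_eq_pow (y : ℝ) :
    Real.exp (-Real.pi * y) = Real.exp (-Real.pi * (y / 4)) ^ 4 := by
  rw [← Real.exp_nat_mul]; congr 1; push_cast; ring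

theorem exp_neg_pi_half_eq_pow (y : ℝ) :
    Real.exp (-Real.pi * (y / 2)) = Real.exp (-Real.pi * (y / 4)) ^ 2 := by
  rw [← Real.exp_nat_mul]; congr 1; push_cast; ring

theorem norm_thetaSum_zero_zero_sub_one_le_of_reduced (hy : Real.sqrt 3 / 2 ≤ p.im)
    (hr : p.im ≤ r.im) (hq0 : 0 ≤ q.im) (hq : 2 * q.im ≤ p.im) (c d : ℤ) :
    ‖thetaSum p q r 0 0 c d - 1‖ ≤ 0.585 := by
  have hp : 0 < p.im := lt_of_lt_of_le (by positivity) hy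
  obtain ⟨h1, -, h3, -, h5⟩ := geometric_bounds (Real.exp_pos _).le (exp_neg_pi_div_four_le hy)
  refine (norm_thetaSum_sub_one_le hp le_rfl hr hq0 hq c d rfl).trans ?_
  rw [exp_neg_pi_eq_pow, div_eq_mul_one_div (2 : ℝ)]
  set w := Real.exp (-Real.pi * (p.im / 4)) ^ 4
  generalize 1 / (1 - w) = g at *
  calc w * ((1 + 2 * g) * (1 + 2 * g) - 1) ≤ 0.06592 *
        ((1 + 2 * 1.0706) * (1 + 2 * 1.0706) - 1) := by
        gcongr
        nlinarith
    _ ≤ _ := by norm_num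

/-- The estimate for characteristics `(1 0 0 d)`, for a parameter `y` reducing the matrix. -/
theorem norm_thetaSum_one_zero_sub_le_of_reduced {y : ℝ} (hy : Real.sqrt 3 / 2 ≤ y)
    (hp : y ≤ p.im) (hr : y ≤ r.im) (hq0 : 0 ≤ q.im) (hq : 2 * q.im ≤ y) (d : ℤ) :
    ‖thetaSum p q r 1 0 0 d - 2 * Complex.exp (Real.pi * Complex.I * (p / 4))‖ ≤
      1.621 * Real.exp (-Real.pi * (p.im / 4)) := by
  have hy0 : 0 < y := lt_of_lt_of_le (by positivity) hy
  obtain ⟨h1, h2, h3, h4, -⟩ := geometric_bounds (Real.exp_pos _).le (exp_neg_pi_div_four_le hy)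
  refine (norm_thetaSum_one_zero_sub_le hy0 hp hr hq0 hq d rfl rfl).trans ?_
  rw [exp_neg_pi_eq_pow y, exp_neg_pi_half_eq_pow y, div_eq_mul_one_div (2 : ℝ), mul_comm]
  gcongr
  generalize 1 / (1 - Real.exp (-Real.pi * (y / 4)) ^ 4) = g at *
  generalize (1 + Real.exp (-Real.pi * (y / 4)) ^ 2) / (1 - Real.exp (-Real.pi * (y / 4)) ^ 2) = k
    at *
  -- `2 · 1.0706 · 1.691 - 2 < 1.621`, which leaves `2 - 1.621 = 0.379` of the leading term.
  have hgk : g * k ≤ 1.0706 * 1.691 := by gcongr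
  linarith

theorem norm_thetaSum_one_zero_bounds {y : ℝ} (hy : Real.sqrt 3 / 2 ≤ y)
    (hp : y ≤ p.im) (hr : y ≤ r.im) (hq0 : 0 ≤ q.im) (hq : 2 * q.im ≤ y) (d : ℤ) :
    0.379 * Real.exp (-Real.pi * (p.im / 4)) ≤ ‖thetaSum p q r 1 0 0 d‖ ∧
      ‖thetaSum p q r 1 0 0 d‖ ≤ 3.621 * Real.exp (-Real.pi * (p.im / 4)) := by
  have h := norm_thetaSum_one_zero_sub_le_of_reduced hy hp hr hq0 hq d
  have hl : ‖2 * Complex.exp (Real.pi * Complex.I * (p / 4))‖ =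
      2 * Real.exp (-Real.pi * (p.im / 4)) := by
    rw [norm_mul, norm_cexp_pi_mul_I_mul, Complex.norm_two, Complex.div_ofNat_im]
  have h1 := norm_sub_norm_le (thetaSum p q r 1 0 0 d)
    (2 * Complex.exp (Real.pi * Complex.I * (p / 4)))
  have h2 := norm_sub_norm_le (2 * Complex.exp (Real.pi * Complex.I * (p / 4)))
    (thetaSum p q r 1 0 0 d)
  rw [norm_sub_rev] at h2
  constructor <;> linarith

theorem norm_thetaSum_one_one_le_of_reduced (hy : Real.sqrt 3 / 2 ≤ p.im)
    (hr : p.im ≤ r.im) (hq0 : 0 ≤ q.im) (hq : 2 * q.im ≤ p.im) (c d : ℤ) :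
    ‖thetaSum p q r 1 1 c d‖ ≤ 2.33 := by
  have hp : 0 < p.im := lt_of_lt_of_le (by positivity) hy
  obtain ⟨h1, -, h3, -, -⟩ := geometric_bounds (Real.exp_pos _).le (exp_neg_pi_div_four_le hy)
  refine (norm_thetaSum_one_one_le hp le_rfl hr hq0 hq c d rfl).trans ?_
  rw [exp_neg_pi_eq_pow p.im, div_eq_mul_one_div (2 : ℝ)]
  generalize 1 / (1 - Real.exp (-Real.pi * (p.im / 4)) ^ 4) = g at *
  have hL := exp_neg_pi_div_four_le (y := p.im - 2 * q.im + r.im) (by linarith)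
  calc Real.exp (-Real.pi * ((p.im - 2 * q.im + r.im) / 4)) * (2 * g * (2 * g)) ≤
      0.5067 * (2 * 1.0706 * (2 * 1.0706)) := by gcongr
    _ ≤ 2.33 := by norm_num

theorem norm_thetaSum_one_one_ge_of_reduced (hy : Real.sqrt 3 / 2 ≤ p.im)
    (hr : p.im ≤ r.im) (hq0 : 0 ≤ q.im) (hq : 2 * q.im ≤ p.im) (hre : |q.re| ≤ 1 / 2) :
    1.41 * Real.exp (-Real.pi * (r.im / 2)) ≤ ‖thetaSum p q r 1 1 0 0‖ := by
  have hp : 0 < p.im := lt_of_lt_of_le (by positivity) hy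
  obtain ⟨h1, -, h3, -, -⟩ := geometric_bounds (Real.exp_pos _).le (exp_neg_pi_div_four_le hy)
  have h := norm_thetaSum_one_one_sub_le hp le_rfl hr hq0 hq rfl
  rw [exp_neg_pi_eq_pow p.im, div_eq_mul_one_div (2 : ℝ)] at h
  generalize 1 / (1 - Real.exp (-Real.pi * (p.im / 4)) ^ 4) = g at *
  have hL : Real.exp (-Real.pi * (r.im / 2)) ≤
      Real.exp (-Real.pi * ((p.im - 2 * q.im + r.im) / 4)) := by
    rw [Real.exp_le_exp]
    nlinarith [Real.pi_pos]
  have him : ((p - 2 * q + r) / 4).im = (p.im - 2 * q.im + r.im) / 4 := by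
    rw [Complex.div_ofNat_im]
    simp
  have hlead : 2 * Real.exp (-Real.pi * ((p.im - 2 * q.im + r.im) / 4)) ≤
      ‖2 * Complex.exp (Real.pi * Complex.I * ((p - 2 * q + r) / 4)) *
        (1 + Complex.exp (Real.pi * Complex.I * q))‖ := by
    rw [norm_mul, norm_mul, norm_cexp_pi_mul_I_mul, him, Complex.norm_two]
    exact le_mul_of_one_le_right (by positivity) (one_le_norm_one_add_exp hre)
  have h2 := norm_sub_norm_le (2 * Complex.exp (Real.pi * Complex.I * ((p - 2 * q + r) / 4)) *
    (1 + Complex.exp (Real.pi * Complex.I * q))) (thetaSum p q r 1 1 0 0)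
  rw [norm_sub_rev] at h2
  set L := Real.exp (-Real.pi * ((p.im - 2 * q.im + r.im) / 4))
  have hL0 : 0 < L := Real.exp_pos _
  -- `4 · 1.0706 ^ 2 - 4 < 0.59`, hence the factor `1.41 = 2 - 0.59`.
  have h4 : L * (2 * g * (2 * g) - 4) ≤ L * 0.59 := by
    gcongr
    nlinarith
  linarith

end Reduced

theorem maxThetaConst_le_of_mem_fundamentalDomain {τ : Matrix (Fin 2) (Fin 2) ℂ}
    (hτ : τ ∈ fundamentalDomain) : maxThetaConst τ ≤ 2.33 := by
  have hy := sqrt_three_div_two_le_im_of_mem_fundamentalDomain hτ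
  obtain ⟨hH, -, ⟨hq0, hq, hr⟩, -⟩ := hτ
  have h10 := (mem_siegelHalfSpace_two_iff.1 hH).1
  have hq0' : 0 ≤ (τ 0 1).im := by linarith
  obtain ⟨i, hi⟩ := exists_norm_thetaConst_eq_max τ
  rw [← hi, thetaConst_evenChar h10]
  have h00 (c d : ℤ) : ‖thetaSum (τ 0 0) (τ 0 1) (τ 1 1) 0 0 c d‖ ≤ 2.33 := by
    have h := norm_thetaSum_zero_zero_sub_one_le_of_reduced hy hr hq0' hq c d
    have h1 := norm_sub_norm_le (thetaSum (τ 0 0) (τ 0 1) (τ 1 1) 0 0 c d) 1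
    rw [norm_one] at h1
    linarith
  have hε := exp_neg_pi_div_four_le hy
  have hη := exp_neg_pi_div_four_le (hy.trans hr)
  have h1 (d : ℤ) : ‖thetaSum (τ 0 0) (τ 0 1) (τ 1 1) 1 0 0 d‖ ≤ 2.33 := by
    linarith [(norm_thetaSum_one_zero_bounds hy le_rfl hr hq0' hq d).2]
  have h2 (c : ℤ) : ‖thetaSum (τ 0 0) (τ 0 1) (τ 1 1) 0 1 c 0‖ ≤ 2.33 := by
    rw [← thetaSum_swap]
    linarith [(norm_thetaSum_one_zero_bounds hy hr le_rfl hq0' hq c).2]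
  have h3 := norm_thetaSum_one_one_le_of_reduced hy hr hq0' hq
  fin_cases i
  exacts [h00 _ _, h00 _ _, h00 _ _, h00 _ _, h2 _, h2 _, h1 _, h1 _, h3 _ _, h3 _ _]

theorem le_norm_thetaConst_of_mem_fundamentalDomain {τ : Matrix (Fin 2) (Fin 2) ℂ}
    (hτ : τ ∈ fundamentalDomain) {t : ℝ} (ht : (τ 1 1).im ≤ t) (i : Fin 10) (hi : i ≠ 9) :
    1.22 * Real.exp (-Real.pi * t) * maxThetaConst τ ≤ ‖thetaConst (evenChar i) τ‖ := by
  have hmax := maxThetaConst_le_of_mem_fundamentalDomain hτ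
  have hy := sqrt_three_div_two_le_im_of_mem_fundamentalDomain hτ
  obtain ⟨hH, hre, ⟨hq0, hq, hr⟩, -⟩ := hτ
  have h10 := (mem_siegelHalfSpace_two_iff.1 hH).1
  have hq0' : 0 ≤ (τ 0 1).im := by linarith
  rw [thetaConst_evenChar h10]
  have hη := exp_neg_pi_div_four_le (hy.trans hr)
  have hη0 : 0 < Real.exp (-Real.pi * ((τ 1 1).im / 4)) := Real.exp_pos _
  have hεη : Real.exp (-Real.pi * ((τ 1 1).im / 4)) ≤ Real.exp (-Real.pi * ((τ 0 0).im / 4)) := by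
    rw [Real.exp_le_exp]
    nlinarith [Real.pi_pos]
  have h11 := norm_thetaSum_one_one_ge_of_reduced hy hr hq0' hq (hre 0 1)
  rw [exp_neg_pi_half_eq_pow] at h11
  have h1 (d : ℤ) := (norm_thetaSum_one_zero_bounds hy le_rfl hr hq0' hq d).1
  have h2 (c : ℤ) := (norm_thetaSum_one_zero_bounds hy hr le_rfl hq0' hq c).1
  -- `2.8426 = 1.22 · 2.33`; what remains is a comparison of powers of `η = exp (-π y₄ / 4)`.
  have hle : 1.22 * Real.exp (-Real.pi * t) * maxThetaConst τ ≤
      2.8426 * Real.exp (-Real.pi * ((τ 1 1).im / 4)) ^ 4 := by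
    rw [← exp_neg_pi_eq_pow]
    have he : Real.exp (-Real.pi * t) ≤ Real.exp (-Real.pi * (τ 1 1).im) := by
      rw [Real.exp_le_exp]
      nlinarith [Real.pi_pos]
    have hmax0 : 0 ≤ maxThetaConst τ := (norm_nonneg _).trans (norm_thetaConst_le_max τ i)
    calc _ ≤ 1.22 * Real.exp (-Real.pi * (τ 1 1).im) * 2.33 := by gcongr
      _ = _ := by ring
  refine hle.trans ?_
  generalize Real.exp (-Real.pi * ((τ 1 1).im / 4)) = η at *
  have hη2 : η ^ 2 ≤ 0.5067 ^ 2 := by gcongr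
  have hη3 : η ^ 3 ≤ 0.5067 ^ 3 := by gcongr
  have hη4 : η ^ 4 ≤ 0.5067 ^ 4 := by gcongr
  norm_num at hη2 hη3 hη4
  -- The tightest comparison, which limits the constant `1.22`: `2.8426 · 0.5067 ^ 3 ≈ 0.370`.
  have b1 : 2.8426 * η ^ 4 ≤ 0.379 * η := by
    have := mul_le_mul_of_nonneg_left hη3 hη0.le
    linarith
  have b2 : 2.8426 * η ^ 4 ≤ 1.41 * η ^ 2 := by
    have := mul_le_mul_of_nonneg_left hη2 (sq_nonneg η)
    nlinarith
  have h00 (c d : ℤ) : 2.8426 * η ^ 4 ≤ ‖thetaSum (τ 0 0) (τ 0 1) (τ 1 1) 0 0 c d‖ := by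
    have h := norm_thetaSum_zero_zero_sub_one_le_of_reduced hy hr hq0' hq c d
    have h1 := norm_sub_norm_le 1 (thetaSum (τ 0 0) (τ 0 1) (τ 1 1) 0 0 c d)
    rw [norm_one, norm_sub_rev] at h1
    linarith
  have h1' (d : ℤ) : 2.8426 * η ^ 4 ≤ ‖thetaSum (τ 0 0) (τ 0 1) (τ 1 1) 1 0 0 d‖ := by
    linarith [h1 d]
  have h2' (c : ℤ) : 2.8426 * η ^ 4 ≤ ‖thetaSum (τ 0 0) (τ 0 1) (τ 1 1) 0 1 c 0‖ := by
    rw [← thetaSum_swap]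
    linarith [h2 c]
  fin_cases i
  exacts [h00 _ _, h00 _ _, h00 _ _, h00 _ _, h2' _, h2' _, h1' _, h1' _, b2.trans h11,
    (hi rfl).elim]

end SiegelTheta

/-! ### Conclusion -/

theorem mainTheorem10 (τ : Matrix (Fin 2) (Fin 2) ℂ) (hτ : τ ∈ SiegelTheta.siegelHalfSpace 2)
    (t : ℝ) (ht : Real.sqrt 3 / 2 ≤ t) :
    (SiegelTheta.evenChars.filter fun m =>
        ‖SiegelTheta.thetaConst m τ‖ < 0.42 * SiegelTheta.maxThetaConst τ).card ≤ 6 ∧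
    ((∃ γ ∈ Matrix.symplecticGroup (Fin 2) ℤ,
        SiegelTheta.siegelAct γ τ ∈ SiegelTheta.fundamentalDomain ∧
        (SiegelTheta.siegelAct γ τ 1 1).im ≤ t) →
      (SiegelTheta.evenChars.filter fun m =>
        ‖SiegelTheta.thetaConst m τ‖ <
          1.22 * Real.exp (-Real.pi * t) * SiegelTheta.maxThetaConst τ).card ≤ 1) := by
  refine ⟨SiegelTheta.card_small_theta_le_six hτ (by norm_num), ?_⟩
  rintro ⟨γ, hγ, hF, hle⟩
  obtain ⟨-, hH, hequiv⟩ := SiegelTheta.permutesThetas_of_mem_symplecticGroup hγ τ hτ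
  -- Index 9 is the characteristic `(1111)`.
  exact hequiv.card_small_le_one (SiegelTheta.mem_siegelHalfSpace_two_iff.1 hτ).1
    (SiegelTheta.mem_siegelHalfSpace_two_iff.1 hH).1 (by positivity) 9
    (SiegelTheta.le_norm_thetaConst_of_mem_fundamentalDomain hF hle)
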